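/- Let $n,d\ge 1$, let $Q\subset\mathbb{R}^d$ be convex and compact, let $\phi$ be a continuous, strictly positive probability density on $Q$ (so $\int_Q\phi(q)\,dq=1$), and let $f:[0,\infty)\to[0,\infty)$ be strictly increasing and three times continuously differentiable on $[0,\infty)$ (one-sided at $0$), with $f(0)=0$. For $\bm{x}=(x_1,\dots,x_n)\in(\mathbb{R}^d)^n=\mathbb{R}^{nd}$ put $$\mathcal{H}(\bm{x})=\int_Q \min_{1\le i\le n} f(\|q-x_i\|)\,\phi(q)\,dq ,$$ where $\|\cdot\|$ is the Euclidean norm, and let $S=\{\bm{x}\in Q^n : x_i=x_j \text{ for some } i\neq j\}$. Then $\mathcal{H}$ is differentiable at every point of $Q^n\setminus S$ (as a function on $\mathbb{R}^{nd}$), and its gradient $\nabla\mathcal{H}$ is continuously differentiable on $Q^n\setminus S$. (Here $Q^n\setminus S$ is relatively open in the convex set $Q^n$, which has nonempty interior; at its boundary points the derivative of $\nabla\mathcal{H}$ is taken relative to $Q^n\setminus S$.) -/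

import Mathlib

open scoped Gradient

/-- The space `ℝ^{nd}` of configurations of `n` points of `ℝ^d`: the Euclidean (`ℓ²`) sum of `n`
copies of Euclidean `d`-space, so that `x i` is the position of the `i`-th sensor. -/
abbrev Config (n d : ℕ) : Type := PiLp 2 (fun _ : Fin n => EuclideanSpace ℝ (Fin d))

/-- `Q^n`: the configurations all of whose sensors lie in `Q`. -/
def configsIn {n d : ℕ} (Q : Set (EuclideanSpace ℝ (Fin d))) : Set (Config n d) :=
  {x | ∀ i, x i ∈ Q}

/-- `S`: the configurations in `Q^n` in which two different sensors have the same position. -/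
def coincident {n d : ℕ} (Q : Set (EuclideanSpace ℝ (Fin d))) : Set (Config n d) :=
  {x | x ∈ configsIn Q ∧ ∃ i j, i ≠ j ∧ x i = x j}

/-- The expected-value multicenter function
`H(x) = ∫_Q min_i f(‖q - x_i‖) φ(q) dq`. For `n ≥ 1` the infimum is over a finite nonempty
family of reals, hence is the minimum. -/
noncomputable def multicenter {n d : ℕ} (Q : Set (EuclideanSpace ℝ (Fin d))) (f : ℝ → ℝ)
    (φ : EuclideanSpace ℝ (Fin d) → ℝ) (x : Config n d) : ℝ :=
  ∫ q in Q, (⨅ i : Fin n, f ‖q - x i‖) * φ q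

open MeasureTheory Set Filter Topology Function
open scoped Gradient RealInnerProductSpace

/-! Only the values of `f` on `[0, ∞)` matter, so `f` is replaced by a C² function `F` on the whole
line. For almost every `q` exactly one `x i` is nearest, and it stays nearest under small changes of
`x`; there the integrand is locally `F ‖q - x i‖ * φ q`. Differentiating under the integral
(`hasGradientAt_integral_iInf`) produces no boundary terms: block `i` of the gradient is minus the
integral of `φ` times the radial field of `F'` about `x i` over the Voronoi cell of `x i` in `Q`.

To differentiate once more, the centre of the field and the half-spaces cutting out the cell are
treated as independent variables of `cellIntegral`, composed with the smooth map `voronoiData`.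
Moving the centre differentiates the field, whose derivative is `O(1 + |g 0| / ‖v‖)` and so
integrable if `d ≥ 2` or `g 0 = 0`. Moving a half-space gives an integral over its bounding
hyperplane; averaging over translates along a transversal vector expresses it without surface
measure (`hasFDerivAt_integral_halfspace`). Both partial derivatives are continuous in general
position: pairwise distinct hyperplanes, each cutting the interior of `Q` and missing the centre
(`contDiffAt_cellIntegral`). Distinct points of `Q` have such bisectors
(`generalPosition_voronoiData`).

For `d = 1` the field may jump at its centre. The jump is localised inside the cell, which reduces
it to an integral over all of `Q`, computed by the fundamental theorem of calculus
(`exists_contDiff_integral_radialField_one`). That formula holds only for centres in `Q`, whence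
differentiability relative to `Q^n`. -/

theorem hasFDerivAt_pi_of_partial {ι W V : Type*} [Fintype ι] [DecidableEq ι]
    [NormedAddCommGroup W] [NormedSpace ℝ W] [NormedAddCommGroup V] [NormedSpace ℝ V]
    {f : (ι → W) → V} {f' : ι → (ι → W) → W →L[ℝ] V} {x : ι → W}
    (hf : ∀ᶠ y in 𝓝 x, ∀ k, HasFDerivAt (fun w => f (update y k w)) (f' k y) (y k))
    (hc : ∀ k, ContinuousAt (f' k) x) :
    HasFDerivAt f (∑ k, (f' k x).comp (ContinuousLinearMap.proj k)) x := by
  rw [hasFDerivAt_iff_isLittleO_nhds_zero, Asymptotics.isLittleO_iff]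
  intro ε hε
  obtain ⟨ε', hε', hle⟩ : ∃ ε' > 0, Fintype.card ι * ε' ≤ ε := by
    refine ⟨ε / (Fintype.card ι + 1), by positivity, ?_⟩
    rw [mul_div_assoc', div_le_iff₀ (by positivity)]
    nlinarith [hε.le]
  have hc' : ∀ᶠ y in 𝓝 x, ∀ k, ‖f' k y - f' k x‖ ≤ ε' := by
    rw [eventually_all]
    intro k
    filter_upwards [Metric.tendsto_nhds.1 (hc k) ε' hε'] with y hy
    rw [← dist_eq_norm]
    exact hy.le
  obtain ⟨r, hr, hball⟩ := Metric.eventually_nhds_iff_ball.1 (hf.and hc')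
  filter_upwards [Metric.ball_mem_nhds (0 : ι → W) hr] with v hv
  have hv' : ∀ k, ‖v k‖ < r := fun k => (norm_le_pi_norm v k).trans_lt (by simpa using hv)
  -- The coordinates are switched from `x` to `x + v` one at a time; by the mean value inequality
  -- each switch costs at most `ε' * ‖v‖`.
  have key : ∀ s : Finset ι, ‖f (s.piecewise (x + v) x) - f x - ∑ k ∈ s, f' k x (v k)‖
      ≤ ∑ _k ∈ s, ε' * ‖v‖ := by
    intro s
    induction s using Finset.induction_on with
    | empty => simp
    | insert k s hk ih =>
      set y := s.piecewise (x + v) x with hy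
      have hyk : y k = x k := by simp [hy, hk]
      have hmem : ∀ w ∈ Metric.ball (x k) r, update y k w ∈ Metric.ball x r := by
        intro w hw
        rw [mem_ball_iff_norm, pi_norm_lt_iff hr]
        intro l
        by_cases hl : l = k
        · subst hl
          simpa [← dist_eq_norm] using hw
        · rw [Pi.sub_apply, update_of_ne hl, hy]
          by_cases hls : l ∈ s
          · simpa [hls] using hv' l
          · simpa [hls] using hr
      have hd : ∀ w ∈ Metric.ball (x k) r, HasFDerivWithinAt (fun w => f (update y k w))
          (f' k (update y k w)) (Metric.ball (x k) r) w := by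
        intro w hw
        have := (hball _ (hmem w hw)).1 k
        simp only [update_idem, update_self] at this
        exact this.hasFDerivWithinAt
      have hmv := (convex_ball (x k) r).norm_image_sub_le_of_norm_hasFDerivWithin_le' hd
        (fun w hw => (hball _ (hmem w hw)).2 k) (Metric.mem_ball_self hr)
        (y := x k + v k) (by simpa [mem_ball_iff_norm] using hv' k)
      rw [Finset.piecewise_insert, Finset.sum_insert hk, Finset.sum_insert hk]
      have e1 : update y k (x k) = y := by rw [← hyk, update_eq_self]
      rw [e1, add_sub_cancel_left] at hmv
      have e2 : f (update y k ((x + v) k)) - f x - (f' k x (v k) + ∑ l ∈ s, f' l x (v l))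
          = (f (update y k (x k + v k)) - f y - f' k x (v k))
            + (f y - f x - ∑ l ∈ s, f' l x (v l)) := by
        rw [Pi.add_apply]; abel
      rw [e2]
      refine (norm_add_le _ _).trans (add_le_add (hmv.trans ?_) ih)
      gcongr
      exact norm_le_pi_norm v k
  have := key Finset.univ
  simp only [Finset.piecewise_univ, Finset.sum_const, Finset.card_univ, nsmul_eq_mul] at this
  simp only [_root_.sum_apply, ContinuousLinearMap.comp_apply,
    ContinuousLinearMap.proj_apply]
  refine this.trans ?_
  rw [← mul_assoc]
  gcongr

/-! ### Radial fields: Lipschitz and integrability bounds near the centre -/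

/-- The radial vector field `v ↦ g(‖v‖) v / ‖v‖`, with value `0` at the origin. -/
noncomputable def radialField {E : Type*} [NormedAddCommGroup E] [NormedSpace ℝ E]
    (g : ℝ → ℝ) (v : E) : E := (g ‖v‖ / ‖v‖) • v

section RadialField

variable {E : Type*} [NormedAddCommGroup E]

theorem norm_radialField_le [NormedSpace ℝ E] (g : ℝ → ℝ) (v : E) :
    ‖radialField g v‖ ≤ |g ‖v‖| := by
  rcases eq_or_ne v 0 with rfl | hv
  · simp [radialField]
  · rw [radialField, norm_smul, Real.norm_eq_abs, abs_div, abs_norm,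
      div_mul_cancel₀ _ (norm_ne_zero_iff.2 hv)]

/-- The difference is `‖b‖⁻¹ • (a - b)` plus a multiple of `a`, each of norm at most `‖a - b‖ /
‖b‖`. -/
theorem norm_div_norm_sub_le [NormedSpace ℝ E] {a b : E} (hb : b ≠ 0) :
    ‖‖a‖⁻¹ • a - ‖b‖⁻¹ • b‖ ≤ 2 / ‖b‖ * ‖a - b‖ := by
  have hb' : 0 < ‖b‖ := norm_pos_iff.2 hb
  rcases eq_or_ne a 0 with rfl | ha
  · simp only [norm_zero, inv_zero, zero_smul, zero_sub, norm_neg, norm_smul, norm_inv, norm_norm]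
    rw [inv_mul_cancel₀ hb'.ne', div_mul_cancel₀ _ hb'.ne']
    norm_num
  have ha' : 0 < ‖a‖ := norm_pos_iff.2 ha
  have h1 : ‖a‖⁻¹ • a - ‖b‖⁻¹ • b = ‖b‖⁻¹ • (a - b) + (‖a‖⁻¹ - ‖b‖⁻¹) • a := by
    rw [smul_sub, sub_smul]; abel
  have h2 : ‖(‖a‖⁻¹ - ‖b‖⁻¹) • a‖ ≤ ‖b‖⁻¹ * ‖a - b‖ := by
    have h3 : ‖a‖⁻¹ - ‖b‖⁻¹ = ‖a‖⁻¹ * (‖b‖⁻¹ * (‖b‖ - ‖a‖)) := by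
      field_simp
    rw [norm_smul, h3, norm_mul, norm_mul, norm_inv, norm_inv, norm_norm, norm_norm,
      Real.norm_eq_abs]
    have h4 := abs_norm_sub_norm_le b a
    rw [norm_sub_rev] at h4
    calc ‖a‖⁻¹ * (‖b‖⁻¹ * |‖b‖ - ‖a‖|) * ‖a‖ = ‖b‖⁻¹ * |‖b‖ - ‖a‖| := by field_simp
      _ ≤ _ := by gcongr
  rw [h1]
  refine (norm_add_le _ _).trans ?_
  rw [norm_smul, norm_inv, norm_norm]
  calc _ ≤ ‖b‖⁻¹ * ‖a - b‖ + ‖b‖⁻¹ * ‖a - b‖ := by gcongr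
    _ = _ := by ring

/-- Write `g = (g - g 0) + g 0`. The first part vanishes at the centre and gives a Lipschitz field;
only the constant part is singular. Since `a` is arbitrary, even `0`, the bound can serve as
domination when the centre moves. -/
theorem norm_radialField_sub_le [NormedSpace ℝ E] {g : ℝ → ℝ} {K : NNReal}
    (hg : LipschitzWith K g) {a b : E} (hb : b ≠ 0) :
    ‖radialField g a - radialField g b‖ ≤ (3 * K + 2 * |g 0| / ‖b‖) * ‖a - b‖ := by
  have hb' : 0 < ‖b‖ := norm_pos_iff.2 hb
  set u : E → E := fun v => ‖v‖⁻¹ • v with hu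
  have hF : ∀ v : E, radialField g v = (g ‖v‖ - g 0) • u v + g 0 • u v := by
    intro v
    rw [← add_smul, sub_add_cancel, radialField, hu, smul_smul, div_eq_mul_inv]
  have hu1 : ∀ v : E, ‖u v‖ ≤ 1 := by
    intro v
    rcases eq_or_ne v 0 with rfl | hv
    · simp [hu]
    · simp [hu, norm_smul, inv_mul_cancel₀ (norm_ne_zero_iff.2 hv)]
  have hL : ∀ s t : ℝ, |g s - g t| ≤ K * |s - t| := fun s t => by
    simpa [Real.dist_eq] using hg.dist_le_mul s t
  have hn : |‖a‖ - ‖b‖| ≤ ‖a - b‖ := abs_norm_sub_norm_le a b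
  have h1 : ‖g 0 • u a - g 0 • u b‖ ≤ 2 * |g 0| / ‖b‖ * ‖a - b‖ := by
    rw [← smul_sub, norm_smul, Real.norm_eq_abs]
    calc _ ≤ |g 0| * (2 / ‖b‖ * ‖a - b‖) := by
          gcongr; exact norm_div_norm_sub_le hb
      _ = _ := by ring
  have h2 : ‖(g ‖a‖ - g 0) • u a - (g ‖b‖ - g 0) • u b‖ ≤ 3 * K * ‖a - b‖ := by
    have e : (g ‖a‖ - g 0) • u a - (g ‖b‖ - g 0) • u b
        = (g ‖a‖ - g ‖b‖) • u a + (g ‖b‖ - g 0) • (u a - u b) := by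
      module
    have h3 : ‖(g ‖a‖ - g ‖b‖) • u a‖ ≤ K * ‖a - b‖ := by
      rw [norm_smul, Real.norm_eq_abs]
      calc _ ≤ |g ‖a‖ - g ‖b‖| * 1 := by gcongr; exact hu1 a
        _ ≤ K * |‖a‖ - ‖b‖| := by rw [mul_one]; exact hL _ _
        _ ≤ _ := by gcongr
    have h4 : ‖(g ‖b‖ - g 0) • (u a - u b)‖ ≤ 2 * K * ‖a - b‖ := by
      rw [norm_smul, Real.norm_eq_abs]
      have h5 := hL ‖b‖ 0
      rw [sub_zero, abs_norm] at h5
      calc _ ≤ (K * ‖b‖) * (2 / ‖b‖ * ‖a - b‖) := by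
            gcongr; exact norm_div_norm_sub_le hb
        _ = _ := by field_simp
    rw [e]
    refine (norm_add_le _ _).trans ((add_le_add h3 h4).trans (le_of_eq (by ring)))
  rw [hF a, hF b, add_sub_add_comm]
  refine (norm_add_le _ _).trans ((add_le_add h2 h1).trans (le_of_eq (by ring)))

variable [InnerProductSpace ℝ E]

theorem contDiffAt_radialField {g : ℝ → ℝ} (hg : ContDiff ℝ 1 g) {v : E} (hv : v ≠ 0) :
    ContDiffAt ℝ 1 (radialField g : E → E) v := by
  have hn : ContDiffAt ℝ 1 (fun v : E => ‖v‖) v := contDiffAt_norm ℝ hv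
  exact ((hg.contDiffAt.comp v hn).div hn (norm_ne_zero_iff.2 hv)).smul contDiffAt_id

theorem norm_fderiv_radialField_le {g : ℝ → ℝ} (hg : ContDiff ℝ 1 g) {K : NNReal}
    (hgL : LipschitzWith K g) {v : E} (hv : v ≠ 0) :
    ‖fderiv ℝ (radialField g : E → E) v‖ ≤ 3 * K + 2 * |g 0| / ‖v‖ := by
  have hd := ((contDiffAt_radialField hg hv).differentiableAt one_ne_zero).hasFDerivAt
  exact hd.le_of_lip' (by positivity) (Eventually.of_forall fun w => norm_radialField_sub_le hgL hv)

variable [MeasurableSpace E] [BorelSpace E]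

theorem measurable_radialField [FiniteDimensional ℝ E] {g : ℝ → ℝ} (hg : Measurable g) :
    Measurable (radialField g : E → E) := by
  have : ProperSpace E := FiniteDimensional.proper_real E
  have : Measurable fun v : E => g ‖v‖ / ‖v‖ := by fun_prop
  exact this.smul measurable_id

/-- In polar coordinates the Jacobian `r ^ (dim - 1)` absorbs `r⁻¹`; this is where dimension at
least two enters. -/
theorem integrableOn_ball_inv_norm [FiniteDimensional ℝ E] (μ : Measure E) [μ.IsAddHaarMeasure]
    (hE : 2 ≤ Module.finrank ℝ E) (r : ℝ) :
    IntegrableOn (fun v : E => ‖v‖⁻¹) (Metric.ball 0 r) μ := by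
  have : Nontrivial E := Module.nontrivial_of_finrank_pos (R := ℝ) (by omega)
  rw [integrableOn_fun_norm_addHaar μ (f := fun r : ℝ => r⁻¹)]
  have h : IntegrableOn (fun y : ℝ => y ^ (Module.finrank ℝ E - 2)) (Ioo 0 r) volume :=
    ((continuous_pow _).integrableOn_Icc (a := 0) (b := r)).mono_set Ioo_subset_Icc_self
  refine h.congr_fun (fun y hy => ?_) measurableSet_Ioo
  have hy0 : y ≠ 0 := hy.1.ne'
  obtain ⟨m, hm⟩ := Nat.exists_eq_add_of_le hE
  simp only [hm, smul_eq_mul, show 2 + m - 2 = m by omega, show 2 + m - 1 = m + 1 by omega]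
  rw [pow_succ, mul_assoc, mul_inv_cancel₀ hy0, mul_one]

theorem integrableOn_ball_radialField_bound [FiniteDimensional ℝ E] (μ : Measure E)
    [μ.IsAddHaarMeasure] {g : ℝ → ℝ} (hE : 2 ≤ Module.finrank ℝ E ∨ g 0 = 0) (K r : ℝ) :
    IntegrableOn (fun v : E => 3 * K + 2 * |g 0| / ‖v‖) (Metric.ball 0 r) μ := by
  refine Integrable.add (integrableOn_const measure_ball_lt_top.ne) ?_
  rcases hE with hE | hg
  · simpa only [div_eq_mul_inv] using (integrableOn_ball_inv_norm μ hE r).const_mul _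
  · simp [hg]

end RadialField

/-! ### Instance shortcuts for `E × ℝ` -/

section ShortcutInstances

variable {E : Type*} [NormedAddCommGroup E] [InnerProductSpace ℝ E]
  {V : Type*} [NormedAddCommGroup V] [NormedSpace ℝ V]

noncomputable instance instNormedSpaceProdReal : NormedSpace ℝ (E × ℝ) := Prod.normedSpace

noncomputable instance instSeminormedAddCommGroupProdRealCLM :
    SeminormedAddCommGroup (E × ℝ →L[ℝ] V) :=
  ContinuousLinearMap.toSeminormedAddCommGroup

end ShortcutInstances

/-! ### Half-spaces and the time at which a line crosses their boundary -/

section Halfspace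

variable {E : Type*} [NormedAddCommGroup E] [InnerProductSpace ℝ E]

/-- The indicator function of the half-space `{q | ⟪c.1, q⟫ ≤ c.2}`. -/
noncomputable def halfspaceInd (c : E × ℝ) (q : E) : ℝ :=
  {q : E | ⟪c.1, q⟫ ≤ c.2}.indicator 1 q

/-- The signed time at which the line `s ↦ q + s • e` meets the hyperplane
`{q | ⟪c.1, q⟫ = c.2}`. -/
noncomputable def hitTime (c : E × ℝ) (e q : E) : ℝ := (c.2 - ⟪c.1, q⟫) / ⟪c.1, e⟫

/-- The point at which the line `s ↦ q + s • e` meets the hyperplane `{q | ⟪c.1, q⟫ = c.2}`. -/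
noncomputable def hitPoint (c : E × ℝ) (e q : E) : E := q + hitTime c e q • e

/-- The velocity with which the hyperplane `{q | ⟪c.1, q⟫ = c.2}` moves at its point `y`, as a
linear function of the velocity of `c`. -/
noncomputable def normalVelocity (y : E) : E × ℝ →L[ℝ] ℝ :=
  ContinuousLinearMap.snd ℝ E ℝ - (innerSL ℝ y).comp (ContinuousLinearMap.fst ℝ E ℝ)

theorem normalVelocity_apply (y : E) (c : E × ℝ) : normalVelocity y c = c.2 - ⟪y, c.1⟫ := by
  simp [normalVelocity]

theorem continuous_normalVelocity : Continuous (normalVelocity : E → E × ℝ →L[ℝ] ℝ) := by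
  unfold normalVelocity
  exact continuous_const.sub (((innerSL ℝ).continuous).clm_comp continuous_const)

theorem norm_normalVelocity_le (y : E) : ‖(normalVelocity y : E × ℝ →L[ℝ] ℝ)‖ ≤ 1 + ‖y‖ := by
  refine ContinuousLinearMap.opNorm_le_bound _ (by positivity) fun c => ?_
  rw [normalVelocity_apply, add_mul, one_mul]
  refine (norm_sub_le _ _).trans (add_le_add (norm_snd_le c) ?_)
  refine (norm_inner_le_norm y c.1).trans ?_
  gcongr
  exact norm_fst_le c

theorem halfspaceInd_nonneg (c : E × ℝ) (q : E) : 0 ≤ halfspaceInd c q :=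
  indicator_nonneg (fun _ _ => zero_le_one) q

theorem halfspaceInd_le_one (c : E × ℝ) (q : E) : halfspaceInd c q ≤ 1 :=
  indicator_le_self' (fun _ _ => zero_le_one) q

theorem isClosed_halfspace (c : E × ℝ) : IsClosed {q : E | ⟪c.1, q⟫ ≤ c.2} :=
  isClosed_le (by fun_prop) continuous_const

theorem continuousAt_halfspaceInd {c : E × ℝ} {q : E} (h : ⟪c.1, q⟫ ≠ c.2) :
    ContinuousAt (fun x : (E × ℝ) × E => halfspaceInd x.1 x.2) (c, q) := by
  have h1 : Continuous fun x : (E × ℝ) × E => ⟪x.1.1, x.2⟫ := by fun_prop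
  have h2 : Continuous fun x : (E × ℝ) × E => x.1.2 := by fun_prop
  rcases h.lt_or_gt with h | h
  · refine (continuousAt_const (y := (1 : ℝ))).congr ?_
    filter_upwards [h1.continuousAt.eventually_lt h2.continuousAt h] with x hx
    simp [halfspaceInd, hx.le]
  · refine (continuousAt_const (y := (0 : ℝ))).congr ?_
    filter_upwards [h2.continuousAt.eventually_lt h1.continuousAt h] with x hx
    simp [halfspaceInd, hx]

theorem halfspaceInd_line {c : E × ℝ} {e : E} (he : 0 < ⟪c.1, e⟫) (q : E) (s : ℝ) :
    halfspaceInd c (q + s • e) = (Iic (hitTime c e q)).indicator 1 s := by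
  have : ⟪c.1, q + s • e⟫ ≤ c.2 ↔ s ≤ hitTime c e q := by
    rw [hitTime, le_div_iff₀ he, inner_add_right, inner_smul_right]
    constructor <;> intro h <;> linarith
  by_cases h : s ≤ hitTime c e q
  · simp [halfspaceInd, this.2 h, h]
  · simp [halfspaceInd, mt this.1 h, h]

theorem continuousAt_hitTime {c : E × ℝ} {e : E} (he : ⟪c.1, e⟫ ≠ 0) (q : E) :
    ContinuousAt (fun c : E × ℝ => hitTime c e q) c := by
  unfold hitTime
  exact ContinuousAt.div (by fun_prop) (by fun_prop) he

theorem hasFDerivAt_hitTime {c : E × ℝ} {e : E} (he : ⟪c.1, e⟫ ≠ 0) (q : E) :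
    HasFDerivAt (fun c : E × ℝ => hitTime c e q)
      ((⟪c.1, e⟫)⁻¹ • normalVelocity (hitPoint c e q)) c := by
  have h1 : ∀ v : E, HasFDerivAt (fun c : E × ℝ => ⟪c.1, v⟫)
      ((innerSL ℝ v).comp (ContinuousLinearMap.fst ℝ E ℝ)) c := fun v => by
    have : (fun c : E × ℝ => ⟪c.1, v⟫) =
        ((innerSL ℝ v).comp (ContinuousLinearMap.fst ℝ E ℝ) : E × ℝ →L[ℝ] ℝ) := by
      ext x; simp [real_inner_comm]
    rw [this]
    exact ContinuousLinearMap.hasFDerivAt _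
  have h2 : HasFDerivAt (fun c : E × ℝ => c.2) (ContinuousLinearMap.snd ℝ E ℝ) c :=
    hasFDerivAt_snd
  have h3 := ((h2.sub (h1 q)).mul ((hasDerivAt_inv he).comp_hasFDerivAt c (h1 e)))
  refine (h3.congr_fderiv ?_).congr_of_eventuallyEq (Eventually.of_forall fun c => ?_)
  · ext x
    · simp [normalVelocity, hitPoint, hitTime]
      field_simp
    · simp [normalVelocity, hitPoint, hitTime]
  · simp [hitTime, div_eq_mul_inv]

/-- The difference of the two quotients is arranged so that only `c`, not `c'`, occurs undifferenced
in a numerator; both denominators are at least `m`. -/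
theorem norm_hitTime_sub_le {c c' : E × ℝ} {e : E} {m A R : ℝ} (hm : 0 < m)
    (hc : m ≤ ⟪c.1, e⟫) (hc' : m ≤ ⟪c'.1, e⟫) (hA : ‖c‖ ≤ A) {q : E} (hq : ‖q‖ ≤ R) :
    |hitTime c' e q - hitTime c e q|
      ≤ ((1 + R) / m + (A + A * R) * ‖e‖ / m ^ 2) * ‖c' - c‖ := by
  have h0 : 0 < ⟪c.1, e⟫ := hm.trans_le hc
  have h0' : 0 < ⟪c'.1, e⟫ := hm.trans_le hc'
  have hA0 : 0 ≤ A := (norm_nonneg _).trans hA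
  have hR0 : 0 ≤ R := (norm_nonneg _).trans hq
  have e1 : hitTime c' e q - hitTime c e q = ((c' - c).2 - ⟪(c' - c).1, q⟫) / ⟪c'.1, e⟫
      - (c.2 - ⟪c.1, q⟫) * ⟪(c' - c).1, e⟫ / (⟪c'.1, e⟫ * ⟪c.1, e⟫) := by
    simp only [hitTime, Prod.fst_sub, Prod.snd_sub, inner_sub_left]
    field_simp
    ring
  have hin : ∀ (x : E × ℝ) (v : E), |⟪x.1, v⟫| ≤ ‖x‖ * ‖v‖ := fun x v =>
    (abs_real_inner_le_norm _ _).trans (by gcongr; exact norm_fst_le x)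
  have h1 : |(c' - c).2 - ⟪(c' - c).1, q⟫| ≤ (1 + R) * ‖c' - c‖ := by
    refine (abs_sub _ _).trans ?_
    have := hin (c' - c) q
    have h2 : |(c' - c).2| ≤ ‖c' - c‖ := norm_snd_le (c' - c)
    have h3 : ‖c' - c‖ * ‖q‖ ≤ ‖c' - c‖ * R := by gcongr
    linarith
  have h2 : |c.2 - ⟪c.1, q⟫| ≤ A + A * R := by
    refine (abs_sub _ _).trans ?_
    have h2 : |c.2| ≤ ‖c‖ := norm_snd_le c
    have h3 : ‖c‖ * ‖q‖ ≤ A * R := by gcongr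
    have := hin c q
    linarith
  rw [e1, add_mul]
  refine (abs_sub _ _).trans (add_le_add ?_ ?_)
  · rw [abs_div, abs_of_pos h0', div_mul_eq_mul_div]
    gcongr
  · rw [abs_div, abs_mul, abs_of_pos (mul_pos h0' h0), div_mul_eq_mul_div, mul_assoc,
      mul_comm ‖e‖, sq]
    have := hin (c' - c) e
    gcongr

/-- The integrand of the derivative of `c ↦ ∫ halfspaceInd c • h`: the integral of `h` over the
bounding hyperplane, weighted by its normal velocity and averaged over the translates
`s • e` with density `θ`. -/
noncomputable def faceIntegrand {V : Type*} [NormedAddCommGroup V] [NormedSpace ℝ V] (θ : ℝ → ℝ)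
    (c : E × ℝ) (e : E) (h : E → V) (q : E) : E × ℝ →L[ℝ] V :=
  (θ (hitTime c e q) / ⟪c.1, e⟫) • (normalVelocity (hitPoint c e q)).smulRight (h (hitPoint c e q))

end Halfspace

/-! ### Averaging over translates; integrals over half-lines -/

section Average

variable {E : Type*} [NormedAddCommGroup E] [NormedSpace ℝ E] [MeasurableSpace E] [BorelSpace E]
  [FiniteDimensional ℝ E] {V : Type*} [NormedAddCommGroup V] [NormedSpace ℝ V]
  [CompleteSpace V]

theorem integral_eq_integral_average (μ : Measure E) [μ.IsAddHaarMeasure] {h : E → V}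
    (hm : StronglyMeasurable h) (hi : Integrable h μ) {θ : ℝ → ℝ} (hθ : Continuous θ)
    (hθi : Integrable θ) (hθ1 : ∫ s, θ s = 1) (e : E) :
    ∫ q, h q ∂μ = ∫ q, (∫ s, θ s • h (q + s • e)) ∂μ := by
  have : ProperSpace E := FiniteDimensional.proper_real E
  have hprod : Integrable (uncurry fun (s : ℝ) (q : E) => θ s • h (q + s • e))
      (volume.prod μ) := by
    have hmeas : AEStronglyMeasurable (uncurry fun (s : ℝ) (q : E) => θ s • h (q + s • e))
        (volume.prod μ) := by
      refine StronglyMeasurable.aestronglyMeasurable ?_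
      refine StronglyMeasurable.smul (hθ.comp continuous_fst).stronglyMeasurable ?_
      exact hm.comp_measurable (Continuous.measurable (by fun_prop))
    rw [integrable_prod_iff hmeas]
    refine ⟨Eventually.of_forall fun s => (hi.comp_add_right (s • e)).smul (θ s), ?_⟩
    have : ∀ s, ∫ q, ‖uncurry (fun (s : ℝ) (q : E) => θ s • h (q + s • e)) (s, q)‖ ∂μ
        = ‖θ s‖ * ∫ q, ‖h q‖ ∂μ := by
      intro s
      simp only [uncurry_apply_pair, norm_smul, integral_const_mul]
      rw [integral_add_right_eq_self (fun q => ‖h q‖) (s • e)]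
    simp only [this]
    exact hθi.norm.mul_const _
  rw [← integral_integral_swap hprod]
  have : ∀ s, ∫ q, θ s • h (q + s • e) ∂μ = θ s • ∫ q, h q ∂μ := by
    intro s
    rw [integral_smul, integral_add_right_eq_self h (s • e)]
  simp only [this]
  rw [integral_smul_const, hθ1, one_smul]

end Average

section LineIntegral

variable {V : Type*} [NormedAddCommGroup V] [NormedSpace ℝ V]

theorem norm_integral_Iic_sub_le {G : ℝ → V} (hG : Integrable G) {B : ℝ} (hB : ∀ s, ‖G s‖ ≤ B)
    (t t' : ℝ) : ‖(∫ s in Iic t', G s) - ∫ s in Iic t, G s‖ ≤ B * |t' - t| := by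
  rw [intervalIntegral.integral_Iic_sub_Iic hG.integrableOn hG.integrableOn]
  exact intervalIntegral.norm_integral_le_of_norm_le_const fun s _ => hB s

theorem hasDerivAt_integral_Iic [CompleteSpace V] {G : ℝ → V} (hG : Integrable G) {t : ℝ}
    (hc : ContinuousAt G t) :
    HasDerivAt (fun t => ∫ s in Iic t, G s) (G t) t := by
  have h := intervalIntegral.integral_hasDerivAt_right (a := 0) (hG.intervalIntegrable)
    (hG.aestronglyMeasurable.stronglyMeasurableAtFilter) hc
  refine (h.add_const (∫ s in Iic (0 : ℝ), G s)).congr_of_eventuallyEq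
    (Eventually.of_forall fun t => ?_)
  simp only
  rw [← intervalIntegral.integral_Iic_sub_Iic hG.integrableOn hG.integrableOn, sub_add_cancel]

end LineIntegral

/-! ### Differentiating an integral over a half-space -/

section Halfspace

variable {E : Type*} [NormedAddCommGroup E] [InnerProductSpace ℝ E]

theorem measurable_halfspaceInd [MeasurableSpace E] [BorelSpace E] (c : E × ℝ) :
    Measurable (halfspaceInd c : E → ℝ) :=
  measurable_one.indicator (isClosed_halfspace c).measurableSet

theorem continuous_hitTime (c : E × ℝ) (e : E) : Continuous fun q => hitTime c e q := by
  unfold hitTime; fun_prop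

theorem continuous_hitPoint (c : E × ℝ) (e : E) : Continuous fun q => hitPoint c e q := by
  have := continuous_hitTime c e
  unfold hitPoint; fun_prop

/-- The density `θ` lives on `|s| < 1`, so averaging enlarges the support of `h` by at most `‖e‖`.
-/
theorem norm_add_smul_le_of_ne_zero {V : Type*} [NormedAddCommGroup V] {θ : ℝ → ℝ}
    (hθ0 : ∀ s, 1 ≤ |s| → θ s = 0) {h : E → V}
    {R : ℝ} (hR : ∀ q, R < ‖q‖ → h q = 0) (e q : E) (s : ℝ) (hq : R + ‖e‖ < ‖q‖) :
    θ s = 0 ∨ h (q + s • e) = 0 := by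
  by_contra! hcon
  have h1 : |s| < 1 := not_le.1 fun hs => hcon.1 (hθ0 s hs)
  have h2 : ‖q + s • e‖ ≤ R := not_lt.1 fun hs => hcon.2 (hR _ hs)
  have h3 : ‖q‖ ≤ ‖q + s • e‖ + ‖s • e‖ := by
    simpa using norm_sub_le (q + s • e) (s • e)
  rw [norm_smul, Real.norm_eq_abs] at h3
  nlinarith [norm_nonneg e]

end Halfspace

section Halfspace

variable {E : Type*} [NormedAddCommGroup E] [InnerProductSpace ℝ E] [MeasurableSpace E]
  [BorelSpace E] [FiniteDimensional ℝ E]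
  {V : Type*} [NormedAddCommGroup V] [NormedSpace ℝ V]

theorem stronglyMeasurable_faceIntegrand {θ : ℝ → ℝ} (hθ : Continuous θ) (c : E × ℝ) (e : E)
    {h : E → V} (hm : StronglyMeasurable h) : StronglyMeasurable (faceIntegrand θ c e h) := by
  have : ProperSpace E := FiniteDimensional.proper_real E
  unfold faceIntegrand
  refine StronglyMeasurable.smul
    ((hθ.comp (continuous_hitTime c e)).div_const _).stronglyMeasurable ?_
  have h1 : StronglyMeasurable fun q => (normalVelocity (hitPoint c e q) : E × ℝ →L[ℝ] ℝ) :=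
    (continuous_normalVelocity.comp (continuous_hitPoint c e)).stronglyMeasurable
  have h2 : StronglyMeasurable fun q => h (hitPoint c e q) :=
    hm.comp_measurable (continuous_hitPoint c e).measurable
  exact (ContinuousLinearMap.smulRightL ℝ (E × ℝ) V).continuous₂.comp_stronglyMeasurable
    (h1.prodMk h2)

/-- Averaging along `e` turns the jump of the indicator into the upper limit `hitTime c e q` of a
one-dimensional integral. That limit depends smoothly on `c`, so for each `q` with `h` continuous at
the hit point the chain rule applies, and dominated differentiation finishes. -/
theorem hasFDerivAt_integral_halfspace [CompleteSpace V] (μ : Measure E)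
    [μ.IsAddHaarMeasure] {h : E → V} (hm : StronglyMeasurable h) {M R : ℝ}
    (hM : ∀ q, ‖h q‖ ≤ M) (hR : ∀ q, R < ‖q‖ → h q = 0)
    {θ : ℝ → ℝ} (hθ : Continuous θ) {T : ℝ} (hθT : ∀ s, |θ s| ≤ T)
    (hθ0 : ∀ s, 1 ≤ |s| → θ s = 0) (hθ1 : ∫ s, θ s = 1)
    {c : E × ℝ} {e : E} (he : 0 < ⟪c.1, e⟫)
    (hcont : ∀ᵐ q ∂μ, ContinuousAt h (hitPoint c e q)) :
    HasFDerivAt (fun c : E × ℝ => ∫ q, halfspaceInd c q • h q ∂μ)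
      (∫ q, faceIntegrand θ c e h q ∂μ) c := by
  have : ProperSpace E := FiniteDimensional.proper_real E
  have hM0 : 0 ≤ M := (norm_nonneg _).trans (hM 0)
  have hT0 : 0 ≤ T := (abs_nonneg _).trans (hθT 0)
  have hθi : Integrable θ := by
    refine hθ.integrable_of_hasCompactSupport
      (HasCompactSupport.intro (isCompact_Icc (a := -1) (b := 1)) fun s hs => hθ0 s ?_)
    by_contra! hcon
    exact hs ⟨(abs_lt.1 hcon).1.le, (abs_lt.1 hcon).2.le⟩
  set G : E → ℝ → V := fun q s => θ s • h (q + s • e) with hG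
  have hGm : ∀ q, StronglyMeasurable (G q) := fun q =>
    hθ.stronglyMeasurable.smul (hm.comp_measurable (Continuous.measurable (by fun_prop)))
  have hGi : ∀ q, Integrable (G q) := fun q => by
    refine (hθi.norm.mul_const M).mono' (hGm q).aestronglyMeasurable
      (Eventually.of_forall fun s => ?_)
    rw [norm_smul]
    gcongr
    exact hM _
  have hGB : ∀ q s, ‖G q s‖ ≤ T * M := fun q s => by
    rw [hG, norm_smul]
    exact mul_le_mul (hθT s) (hM _) (norm_nonneg _) hT0
  have hG0 : ∀ q, R + ‖e‖ < ‖q‖ → G q = 0 := fun q hq => by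
    ext s
    rcases norm_add_smul_le_of_ne_zero hθ0 hR e q s hq with h | h <;> simp [hG, h]
  -- near `c` the integral over the half-space is an integral of integrals over half-lines
  have hinner : Continuous fun c : E × ℝ => ⟪c.1, e⟫ := by fun_prop
  set m := ⟪c.1, e⟫ / 2 with hmdef
  have hmpos : 0 < m := by positivity
  have hnear : ∀ᶠ c' in 𝓝 c, m < ⟪c'.1, e⟫ :=
    hinner.continuousAt.eventually (lt_mem_nhds (by simp only [hmdef]; linarith))
  have hχm : ∀ c : E × ℝ, StronglyMeasurable fun q => halfspaceInd c q • h q := fun c =>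
    (measurable_halfspaceInd c).stronglyMeasurable.smul hm
  have hint : ∀ c : E × ℝ, Integrable (fun q => halfspaceInd c q • h q) μ := fun c => by
    refine Measure.integrableOn_of_bounded (s := Metric.closedBall 0 R) (M := M)
      measure_closedBall_lt_top.ne
      (hχm c).aestronglyMeasurable
      (Eventually.of_forall fun q => ?_) |>.integrable_of_forall_notMem_eq_zero fun q hq => ?_
    · rw [norm_smul, Real.norm_eq_abs, abs_of_nonneg (halfspaceInd_nonneg c q)]
      exact (mul_le_of_le_one_left (norm_nonneg _) (halfspaceInd_le_one c q)).trans (hM q)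
    · rw [hR q (by simpa using hq), smul_zero]
  have hJ : ∀ᶠ c' in 𝓝 c, ∫ q, halfspaceInd c' q • h q ∂μ
      = ∫ q, (∫ s in Iic (hitTime c' e q), G q s) ∂μ := by
    filter_upwards [hnear] with c' hc'
    rw [integral_eq_integral_average μ (hχm c') (hint c') hθ hθi hθ1 e]
    congr 1 with q
    rw [← integral_indicator measurableSet_Iic]
    congr 1 with s
    simp only [halfspaceInd_line (hmpos.trans hc')]
    by_cases hs : s ∈ Iic (hitTime c' e q) <;> simp [hs, hG]
  have hmeas : ∀ c' : E × ℝ,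
      AEStronglyMeasurable (fun q => ∫ s in Iic (hitTime c' e q), G q s) μ := fun c' => by
    simp_rw [← integral_indicator measurableSet_Iic]
    refine StronglyMeasurable.aestronglyMeasurable ?_
    refine StronglyMeasurable.integral_prod_right
      (f := fun q s => (Iic (hitTime c' e q)).indicator (G q) s) ?_
    have : (uncurry fun q s => (Iic (hitTime c' e q)).indicator (G q) s)
        = {x : E × ℝ | x.2 ≤ hitTime c' e x.1}.indicator
          (fun x : E × ℝ => θ x.2 • h (x.1 + x.2 • e)) := by
      ext ⟨q, s⟩
      by_cases hs : s ≤ hitTime c' e q <;> simp [hs, hG]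
    rw [this]
    refine StronglyMeasurable.indicator ?_ ?_
    · exact (hθ.comp continuous_snd).stronglyMeasurable.smul
        (hm.comp_measurable (Continuous.measurable (by fun_prop)))
    · exact measurableSet_le measurable_snd
        ((continuous_hitTime c' e).measurable.comp measurable_fst)
  -- This is the Lipschitz constant of the hitting time for `‖q‖ ≤ R + ‖e‖`; for larger `q` the
  -- half-line integral is zero.
  set C := (1 + (R + ‖e‖)) / m + (‖c‖ + ‖c‖ * (R + ‖e‖)) * ‖e‖ / m ^ 2 with hC
  refine HasFDerivAt.congr_of_eventuallyEq ?_ hJ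
  refine (hasFDerivAt_integral_of_dominated_loc_of_lip' (s := {c' : E × ℝ | m < ⟪c'.1, e⟫})
    (bound := (Metric.closedBall 0 (R + ‖e‖)).indicator fun _ => T * M * C) hnear
    (fun c' _ => hmeas c') ?_ (stronglyMeasurable_faceIntegrand hθ c e hm).aestronglyMeasurable
    ?_ ?_ ?_).2
  · refine ((integrable_indicator_iff (measurableSet_closedBall)).2
      (integrableOn_const (C := ∫ s, ‖θ s‖ * M) (s := Metric.closedBall (0 : E) (R + ‖e‖))
        measure_closedBall_lt_top.ne)).mono' (hmeas c) (Eventually.of_forall fun q => ?_)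
    by_cases hq : q ∈ Metric.closedBall (0 : E) (R + ‖e‖)
    · rw [indicator_of_mem hq]
      refine (norm_integral_le_integral_norm _).trans ((setIntegral_le_integral (hGi q).norm
        (Eventually.of_forall fun s => norm_nonneg _)).trans
        (integral_mono (hGi q).norm (hθi.norm.mul_const M) fun s => ?_))
      simp only [hG, norm_smul]
      gcongr
      exact hM _
    · rw [indicator_of_notMem hq, hG0 q (by simpa using hq)]
      simp
  · refine Eventually.of_forall fun q c' hc' => ?_
    by_cases hq : q ∈ Metric.closedBall (0 : E) (R + ‖e‖)
    · rw [indicator_of_mem hq]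
      refine (norm_integral_Iic_sub_le (hGi q) (hGB q) _ _).trans ?_
      rw [mul_assoc (T * M)]
      gcongr
      exact norm_hitTime_sub_le hmpos (by simp only [hmdef]; linarith) (le_of_lt hc') le_rfl
        (by simpa using hq)
    · rw [indicator_of_notMem hq, hG0 q (by simpa using hq)]
      simp
  · exact (integrable_indicator_iff measurableSet_closedBall).2
      (integrableOn_const measure_closedBall_lt_top.ne)
  · filter_upwards [hcont] with q hq
    have hGc : ContinuousAt (G q) (hitTime c e q) := by
      refine hθ.continuousAt.smul ?_
      refine ContinuousAt.comp (f := fun s : ℝ => q + s • e) (g := h) hq (by fun_prop)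
    have := (hasDerivAt_integral_Iic (hGi q) hGc).hasFDerivAt.comp c
      (hasFDerivAt_hitTime he.ne' q)
    refine this.congr_fderiv ?_
    ext x <;> simp [faceIntegrand, hG, hitPoint, smul_smul] <;> ring_nf

theorem continuousAt_integral_faceIntegrand (μ : Measure E) [μ.IsAddHaarMeasure]
    {X : Type*} [TopologicalSpace X] [FirstCountableTopology X] {h : X → E → V} {x : X}
    (hm : ∀ x, StronglyMeasurable (h x)) {M R : ℝ} (hM : ∀ᶠ x in 𝓝 x, ∀ q, ‖h x q‖ ≤ M)
    (hR : ∀ x q, R < ‖q‖ → h x q = 0)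
    {θ : ℝ → ℝ} (hθ : Continuous θ) {T : ℝ} (hθT : ∀ s, |θ s| ≤ T)
    (hθ0 : ∀ s, 1 ≤ |s| → θ s = 0)
    {c : X → E × ℝ} {e : E} (hc : ContinuousAt c x) (he : 0 < ⟪(c x).1, e⟫)
    (hcont : ∀ᵐ q ∂μ, ContinuousAt (uncurry h) (x, hitPoint (c x) e q)) :
    ContinuousAt (fun x => ∫ q, faceIntegrand θ (c x) e (h x) q ∂μ) x := by
  have : ProperSpace E := FiniteDimensional.proper_real E
  have hM0 : 0 ≤ M := (norm_nonneg _).trans (hM.self_of_nhds 0)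
  have hT0 : 0 ≤ T := (abs_nonneg _).trans (hθT 0)
  have hinner : Continuous fun c : E × ℝ => ⟪c.1, e⟫ := by fun_prop
  set m := ⟪(c x).1, e⟫ / 2 with hmdef
  have hmpos : 0 < m := by positivity
  have hnear : ∀ᶠ y in 𝓝 x, m < ⟪(c y).1, e⟫ :=
    (hinner.continuousAt.comp hc).eventually (lt_mem_nhds (by simp [hmdef, he]))
  refine continuousAt_of_dominated
    (bound := (Metric.closedBall 0 (R + ‖e‖)).indicator fun _ => T / m * ((1 + |R|) * M))
    (Eventually.of_forall fun y =>
      (stronglyMeasurable_faceIntegrand hθ (c y) e (hm y)).aestronglyMeasurable) ?_ ?_ ?_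
  · filter_upwards [hnear, hM] with y hy hMy
    refine Eventually.of_forall fun q => ?_
    by_cases hq : q ∈ Metric.closedBall (0 : E) (R + ‖e‖)
    · rw [indicator_of_mem hq, faceIntegrand, norm_smul]
      refine mul_le_mul ?_ ?_ (norm_nonneg _) (by positivity)
      · rw [norm_div, Real.norm_eq_abs, Real.norm_eq_abs, abs_of_pos (hmpos.trans hy)]
        gcongr
        exact hθT _
      · rw [ContinuousLinearMap.norm_smulRight_apply]
        rcases lt_or_ge R ‖hitPoint (c y) e q‖ with hlt | hge
        · rw [hR y _ hlt, norm_zero, mul_zero]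
          positivity
        · refine mul_le_mul ((norm_normalVelocity_le _).trans ?_) (hMy _) (norm_nonneg _)
            (by positivity)
          gcongr
          exact hge.trans (le_abs_self R)
    · rw [indicator_of_notMem hq, faceIntegrand]
      rcases norm_add_smul_le_of_ne_zero hθ0 (hR y) e q (hitTime (c y) e q)
        (by simpa using hq) with h0 | h0
      · simp [h0]
      · rw [hitPoint, h0]; simp
  · exact (integrable_indicator_iff measurableSet_closedBall).2
      (integrableOn_const measure_closedBall_lt_top.ne)
  · filter_upwards [hcont] with q hq
    have h1 : ContinuousAt (fun y => hitTime (c y) e q) x :=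
      (continuousAt_hitTime he.ne' q).comp (f := c) hc
    have h2 : ContinuousAt (fun y => hitPoint (c y) e q) x :=
      continuousAt_const.add (h1.smul continuousAt_const)
    have h3 : ContinuousAt (fun y => h y (hitPoint (c y) e q)) x :=
      ContinuousAt.comp (f := fun y => (y, hitPoint (c y) e q)) (g := uncurry h) hq
        (continuousAt_id.prodMk h2)
    have h4 : ContinuousAt (fun y => (normalVelocity (hitPoint (c y) e q) : E × ℝ →L[ℝ] ℝ)) x :=
      continuous_normalVelocity.continuousAt.comp h2
    have h5 : ContinuousAt (fun y => θ (hitTime (c y) e q) / ⟪(c y).1, e⟫) x :=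
      (hθ.continuousAt.comp h1).div (hinner.continuousAt.comp hc) he.ne'
    have h6 : ContinuousAt (fun y => (normalVelocity (hitPoint (c y) e q)).smulRight
        (h y (hitPoint (c y) e q))) x :=
      (ContinuousLinearMap.smulRightL ℝ (E × ℝ) V).continuous₂.continuousAt.comp (h4.prodMk h3)
    exact h5.smul h6

end Halfspace

/-! ### General position: bad hit points form a null set -/

section GeneralPosition

variable {E : Type*} [NormedAddCommGroup E] [InnerProductSpace ℝ E]

theorem hitPoint_combo (c : E × ℝ) {e : E} (x y : E) {s t : ℝ} (hst : s + t = 1) :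
    hitPoint c e (s • x + t • y) = s • hitPoint c e x + t • hitPoint c e y := by
  have : hitTime c e (s • x + t • y) = s * hitTime c e x + t * hitTime c e y := by
    simp only [hitTime, inner_add_right, inner_smul_right, ← mul_div_assoc, ← add_div]
    congr 1
    linear_combination (-c.2) * hst
  rw [hitPoint, this, hitPoint, hitPoint]
  module

theorem hitPoint_of_inner_eq {c : E × ℝ} {e q : E} (h : ⟪c.1, q⟫ = c.2) :
    hitPoint c e q = q := by
  simp [hitPoint, hitTime, h]

/-- The hyperplane `{q | ⟪c.1, q⟫ = c.2}` strictly separates two interior points of `Q`. -/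
def Separates (Q : Set E) (c : E × ℝ) : Prop :=
  (∃ q ∈ interior Q, ⟪c.1, q⟫ < c.2) ∧ ∃ q ∈ interior Q, c.2 < ⟪c.1, q⟫

theorem Separates.fst_ne_zero {Q : Set E} {c : E × ℝ} (h : Separates Q c) : c.1 ≠ 0 := by
  obtain ⟨⟨q, -, hq⟩, q', -, hq'⟩ := h
  intro h0
  simp only [h0, inner_zero_left] at hq hq'
  linarith

theorem isOpen_separates (Q : Set E) : IsOpen {c : E × ℝ | Separates Q c} := by
  have h1 : ∀ q : E, Continuous fun c : E × ℝ => ⟪c.1, q⟫ := fun q => by fun_prop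
  have : {c : E × ℝ | Separates Q c} = (⋃ q ∈ interior Q, {c : E × ℝ | ⟪c.1, q⟫ < c.2}) ∩
      ⋃ q ∈ interior Q, {c : E × ℝ | c.2 < ⟪c.1, q⟫} := by
    ext c; simp [Separates]
  rw [this]
  exact (isOpen_biUnion fun q _ => isOpen_lt (h1 q) continuous_snd).inter
    (isOpen_biUnion fun q _ => isOpen_lt continuous_snd (h1 q))

theorem Separates.exists_mem_interior_inner_eq {Q : Set E} (hQ : Convex ℝ Q) {c : E × ℝ}
    (h : Separates Q c) : ∃ q ∈ interior Q, ⟪c.1, q⟫ = c.2 := by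
  obtain ⟨⟨q, hq, hlt⟩, q', hq', hgt⟩ := h
  have hcont : ContinuousOn (fun q => ⟪c.1, q⟫) (interior Q) := by fun_prop
  obtain ⟨r, hr, h⟩ := hQ.interior.isPreconnected.intermediate_value hq hq' hcont ⟨hlt.le, hgt.le⟩
  exact ⟨r, hr, h⟩

variable [MeasurableSpace E] [BorelSpace E] [FiniteDimensional ℝ E]
  (μ : Measure E) [μ.IsAddHaarMeasure]

theorem ae_inner_ne {a : E} (ha : a ≠ 0) (b : ℝ) : ∀ᵐ q ∂μ, ⟪a, q⟫ ≠ b := by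
  let s : AffineSubspace ℝ E :=
    { carrier := {q | ⟪a, q⟫ = b}
      smul_vsub_vadd_mem' := by
        intro t p₁ p₂ p₃ h₁ h₂ h₃
        simp only [mem_ofPred_eq, vsub_eq_sub, vadd_eq_add, inner_add_right, inner_smul_right,
          inner_sub_right] at h₁ h₂ h₃ ⊢
        rw [h₁, h₂, h₃, sub_self, mul_zero, zero_add] }
  have hs : s ≠ ⊤ := by
    intro h
    have hm : ∀ q : E, ⟪a, q⟫ = b := fun q => by
      have : q ∈ s := h ▸ AffineSubspace.mem_top ℝ E q
      exact this
    have h0 := hm 0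
    rw [inner_zero_right] at h0
    have h1 := hm a
    rw [← h0] at h1
    exact ha (inner_self_eq_zero.1 h1)
  have := Measure.addHaar_affineSubspace μ s hs
  rw [ae_iff]
  simp only [not_not, ne_eq]
  exact this

/-- The condition that the hit point on `c` also lies on `c'` says that `q` lies on `c' - ρ • c`,
which is nonzero by independence. Either this is a hyperplane, hence null, or its normal vanishes
(parallel hyperplanes) and no `q` qualifies. -/
theorem ae_inner_hitPoint_ne {c c' : E × ℝ} (h : LinearIndependent ℝ ![c, c']) {e : E}
    (he : ⟪c.1, e⟫ ≠ 0) : ∀ᵐ q ∂μ, ⟪c'.1, hitPoint c e q⟫ ≠ c'.2 := by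
  set ρ := ⟪c'.1, e⟫ / ⟪c.1, e⟫ with hρ
  have hne : c' - ρ • c ≠ 0 := by
    intro h0
    have := (LinearIndependent.pair_iff.1 h) (-ρ) 1 (by rw [← h0]; module)
    exact one_ne_zero this.2
  have key : ∀ q, ⟪c'.1, hitPoint c e q⟫ = c'.2 ↔ ⟪(c' - ρ • c).1, q⟫ = (c' - ρ • c).2 := by
    intro q
    have h1 : ⟪c'.1, hitPoint c e q⟫ - c'.2 = ⟪(c' - ρ • c).1, q⟫ - (c' - ρ • c).2 := by
      simp only [hitPoint, hitTime, inner_add_right, inner_smul_right, Prod.fst_sub, Prod.snd_sub,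
        Prod.smul_fst, Prod.smul_snd, inner_sub_left, inner_smul_left, hρ, smul_eq_mul,
        conj_trivial]
      field_simp
      ring
    constructor <;> intro h <;> linarith
  simp only [ne_eq, key]
  by_cases h1 : (c' - ρ • c).1 = 0
  · refine Eventually.of_forall fun q hq => hne (Prod.ext h1 ?_)
    rw [← hq, h1, inner_zero_left, Prod.snd_zero]
  · exact ae_inner_ne μ h1 _

/-- The hit point is affine in `q`, so the preimage of `Q` is convex and has null frontier. An
interior point `q` of the preimage lies strictly between a point of the preimage and `q₀`, which is
sent into the interior of `Q`; by convexity `q` is sent there too. -/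
theorem Separates.ae_hitPoint_notMem_frontier {Q : Set E} (hQ : Convex ℝ Q) (hQc : IsClosed Q)
    {c : E × ℝ} (h : Separates Q c) (e : E) : ∀ᵐ q ∂μ, hitPoint c e q ∉ frontier Q := by
  obtain ⟨q₀, hq₀, hin⟩ := h.exists_mem_interior_inner_eq hQ
  have hC : Convex ℝ ((fun q => hitPoint c e q) ⁻¹' Q) := by
    intro x hx y hy s t hs ht hst
    simp only [mem_preimage] at hx hy ⊢
    rw [hitPoint_combo c x y hst]
    exact hQ hx hy hs ht hst
  have hnull := hC.addHaar_frontier μ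
  rw [measure_eq_zero_iff_ae_notMem] at hnull
  filter_upwards [hnull] with q hq hfr
  have hqC : q ∈ (fun q => hitPoint c e q) ⁻¹' Q := hQc.frontier_subset hfr
  have hqi : q ∈ interior ((fun q => hitPoint c e q) ⁻¹' Q) := by
    by_contra hni
    exact hq ⟨subset_closure hqC, hni⟩
  have hev : ∀ᶠ ε : ℝ in 𝓝[>] 0, q + ε • (q - q₀) ∈ (fun q => hitPoint c e q) ⁻¹' Q := by
    refine Tendsto.eventually (f := fun ε : ℝ => q + ε • (q - q₀)) (l₂ := 𝓝 q) ?_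
      (mem_interior_iff_mem_nhds.1 hqi)
    refine tendsto_nhdsWithin_of_tendsto_nhds ?_
    have : Continuous fun ε : ℝ => q + ε • (q - q₀) := by fun_prop
    simpa using this.tendsto 0
  obtain ⟨ε, hε, hε0⟩ := (hev.and self_mem_nhdsWithin).exists
  have hε0 : 0 < ε := hε0
  have hcombo : q = (1 + ε)⁻¹ • (q + ε • (q - q₀)) + (ε / (1 + ε)) • q₀ := by
    have h1 : (1 + ε) ≠ 0 := by positivity
    rw [div_eq_inv_mul, mul_smul, ← smul_add, eq_inv_smul_iff₀ h1]
    module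
  have hst : (1 + ε)⁻¹ + ε / (1 + ε) = 1 := by field_simp
  have := hQ.combo_self_interior_mem_interior (x := hitPoint c e (q + ε • (q - q₀)))
    (y := hitPoint c e q₀) hε (by rwa [hitPoint_of_inner_eq hin]) (a := (1 + ε)⁻¹)
    (b := ε / (1 + ε)) (by positivity) (by positivity) hst
  rw [← hitPoint_combo c _ _ hst, ← hcombo] at this
  exact hfr.2 this

end GeneralPosition

/-! ### Differentiating in the centre of the radial field -/

section RadialKernel

variable {E : Type*} [NormedAddCommGroup E] [InnerProductSpace ℝ E] [MeasurableSpace E]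
  [BorelSpace E] [FiniteDimensional ℝ E] [Nontrivial E] (μ : Measure E) [μ.IsAddHaarMeasure]
  {g : ℝ → ℝ} {K : NNReal} {B R : ℝ}

/-- The derivative falls on the field, as `W` may be discontinuous. The result is written in the
variable `v = q - z`, so that the singularity stays at the origin when `z` moves and one integrable
bound serves for continuity as well. -/
theorem hasFDerivAt_integral_smul_radialField (hg : ContDiff ℝ 1 g) (hgK : LipschitzWith K g)
    {G : ℝ} (hG : ∀ r, |g r| ≤ G)
    (hE : 2 ≤ Module.finrank ℝ E ∨ g 0 = 0) {W : E → ℝ} (hW : Measurable W)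
    (hB : ∀ q, |W q| ≤ B) (hR : ∀ q, R < ‖q‖ → W q = 0) (z : E) :
    HasFDerivAt (fun z => ∫ q, W q • radialField g (q - z) ∂μ)
      (-∫ v, W (v + z) • fderiv ℝ (radialField g : E → E) v ∂μ) z := by
  have : ProperSpace E := FiniteDimensional.proper_real E
  have hB0 : 0 ≤ B := (abs_nonneg _).trans (hB 0)
  have hG0 : 0 ≤ G := (abs_nonneg _).trans (hG 0)
  have hFm : Measurable (radialField g : E → E) := measurable_radialField hg.continuous.measurable
  have hshift : -∫ v, W (v + z) • fderiv ℝ (radialField g : E → E) v ∂μ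
      = ∫ q, W q • -fderiv ℝ (radialField g : E → E) (q - z) ∂μ := by
    rw [← integral_neg, ← integral_sub_right_eq_self _ z]
    simp
  rw [hshift]
  set bd : E → ℝ := (Metric.ball 0 (R + ‖z‖ + 1)).indicator
    fun v => B * (3 * K + 2 * |g 0| / ‖v‖) with hbd
  have hbdi : Integrable bd μ := (integrable_indicator_iff measurableSet_ball).2
    ((integrableOn_ball_radialField_bound μ hE K _).const_mul B)
  have hmeas : ∀ z : E, Measurable fun q => W q • radialField g (q - z) := fun z =>
    hW.smul (hFm.comp (measurable_id.sub_const z))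
  have hmem : ∀ q, ‖q‖ ≤ R → q - z ∈ Metric.ball (0 : E) (R + ‖z‖ + 1) := fun q hq => by
    rw [mem_ball_zero_iff]
    linarith [norm_sub_le q z]
  refine (hasFDerivAt_integral_of_dominated_loc_of_lip' (s := univ)
    (bound := fun q => bd (q - z)) univ_mem
    (fun z _ => (hmeas z).aestronglyMeasurable) ?_ ?_ ?_ (hbdi.comp_sub_right z) ?_).2
  · refine IntegrableOn.integrable_of_forall_notMem_eq_zero (s := Metric.closedBall 0 R)
      (Measure.integrableOn_of_bounded (M := B * G) measure_closedBall_lt_top.ne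
      (hmeas z).aestronglyMeasurable (Eventually.of_forall fun q => ?_)) fun q hq => ?_
    · rw [norm_smul]
      exact mul_le_mul (hB q) ((norm_radialField_le g _).trans (hG _)) (norm_nonneg _) hB0
    · rw [hR q (by simpa using hq), zero_smul]
  · refine Measurable.aestronglyMeasurable ?_
    exact hW.smul ((measurable_fderiv ℝ _).comp (measurable_id.sub_const z)).neg
  · filter_upwards [μ.ae_ne z] with q hq z' _
    rw [← smul_sub, norm_smul, Real.norm_eq_abs]
    rcases lt_or_ge R ‖q‖ with hlt | hle
    · rw [hR q hlt, abs_zero, zero_mul]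
      refine mul_nonneg (indicator_nonneg (fun v _ => by positivity) _) (norm_nonneg _)
    · rw [hbd, indicator_of_mem (hmem q hle), mul_assoc]
      have := norm_radialField_sub_le hgK (a := q - z') (sub_ne_zero.2 hq)
      rw [sub_sub_sub_cancel_left, norm_sub_rev z z'] at this
      exact mul_le_mul (hB q) this (norm_nonneg _) hB0
  · filter_upwards [μ.ae_ne z] with q hq
    have h1 := ((contDiffAt_radialField hg (sub_ne_zero.2 hq)).differentiableAt
      one_ne_zero).hasFDerivAt.comp z ((hasFDerivAt_id z).const_sub q)
    refine (h1.const_smul (W q)).congr_fderiv ?_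
    ext x
    simp

theorem continuousAt_integral_smul_fderiv_radialField (hg : ContDiff ℝ 1 g)
    (hgK : LipschitzWith K g) (hE : 2 ≤ Module.finrank ℝ E ∨ g 0 = 0)
    {X : Type*} [TopologicalSpace X] [FirstCountableTopology X] {W : X → E → ℝ} {z : X → E} {x : X}
    (hW : ∀ x, Measurable (W x)) (hB : ∀ x q, |W x q| ≤ B) (hR : ∀ x q, R < ‖q‖ → W x q = 0)
    (hz : ContinuousAt z x) (hc : ∀ᵐ q ∂μ, ContinuousAt (uncurry W) (x, q)) :
    ContinuousAt (fun x => -∫ v, W x (v + z x) • fderiv ℝ (radialField g : E → E) v ∂μ) x := by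
  have : ProperSpace E := FiniteDimensional.proper_real E
  have hB0 : 0 ≤ B := (abs_nonneg _).trans (hB x 0)
  refine ContinuousAt.neg ?_
  have hnear : ∀ᶠ y in 𝓝 x, ‖z y‖ < ‖z x‖ + 1 :=
    hz.norm.eventually (gt_mem_nhds (by linarith))
  refine continuousAt_of_dominated (bound := (Metric.ball 0 (R + ‖z x‖ + 1)).indicator
    fun v => B * (3 * K + 2 * |g 0| / ‖v‖)) (Eventually.of_forall fun y => ?_) ?_
    ((integrable_indicator_iff measurableSet_ball).2
      ((integrableOn_ball_radialField_bound μ hE K _).const_mul B)) ?_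
  · refine Measurable.aestronglyMeasurable ?_
    exact ((hW y).comp (measurable_id.add_const (z y))).smul (measurable_fderiv ℝ _)
  · filter_upwards [hnear] with y hy
    filter_upwards [μ.ae_ne 0] with v hv
    rw [norm_smul, Real.norm_eq_abs]
    rcases lt_or_ge R ‖v + z y‖ with hlt | hle
    · rw [hR y _ hlt, abs_zero, zero_mul]
      exact indicator_nonneg (fun v _ => by positivity) _
    · have hmem : v ∈ Metric.ball (0 : E) (R + ‖z x‖ + 1) := by
        rw [mem_ball_zero_iff]
        have := norm_sub_le (v + z y) (z y)
        rw [add_sub_cancel_right] at this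
        linarith
      rw [indicator_of_mem hmem]
      exact mul_le_mul (hB y _) (norm_fderiv_radialField_le hg hgK hv) (norm_nonneg _) hB0
  · have h1 : ∀ᵐ v ∂μ, ContinuousAt (uncurry W) (x, v + z x) :=
      (measurePreserving_add_right μ (z x)).quasiMeasurePreserving.ae hc
    filter_upwards [h1] with v hv
    have h2 : ContinuousAt (fun y => W y (v + z y)) x :=
      ContinuousAt.comp (f := fun y => (y, v + z y)) (g := uncurry W) hv
        (continuousAt_id.prodMk (continuousAt_const.add hz))
    exact h2.smul continuousAt_const

end RadialKernel

/-! ### The cell integral is C¹ in centre and half-spaces -/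

section CellIntegral

theorem exists_continuous_density : ∃ θ : ℝ → ℝ, Continuous θ ∧ (∃ T, ∀ s, |θ s| ≤ T) ∧
    (∀ s, 1 ≤ |s| → θ s = 0) ∧ ∫ s, θ s = 1 := by
  let b : ContDiffBump (0 : ℝ) := ⟨1 / 2, 1, by norm_num, by norm_num⟩
  refine ⟨b.normed volume, b.continuous_normed, ?_, fun s hs => ?_, b.integral_normed⟩
  · obtain ⟨T, hT⟩ := b.hasCompactSupport_normed (μ := volume) |>.exists_bound_of_continuous
      b.continuous_normed
    exact ⟨T, hT⟩
  · have : s ∉ support (b.normed volume) := by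
      rw [b.support_normed_eq, Real.ball_eq_Ioo]
      intro h
      have := abs_lt.2 (by simpa [b] using h)
      linarith
    simpa using this

variable {E : Type*} [NormedAddCommGroup E] [InnerProductSpace ℝ E]
  {ι : Type*} {w : E → ℝ} {g : ℝ → ℝ}

/-- The weight `w` cut off to the polyhedron given by the half-spaces `c k`, `k ∈ s`. -/
noncomputable def cellWeight (w : E → ℝ) (s : Finset ι) (c : ι → E × ℝ) (q : E) : ℝ :=
  (∏ k ∈ s, halfspaceInd (c k) q) * w q

theorem abs_cellWeight_le {B : ℝ} (hB : ∀ q, |w q| ≤ B) (s : Finset ι) (c : ι → E × ℝ) (q : E) :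
    |cellWeight w s c q| ≤ B := by
  rw [cellWeight, abs_mul, abs_of_nonneg (Finset.prod_nonneg fun k _ => halfspaceInd_nonneg _ _)]
  exact (mul_le_of_le_one_left (abs_nonneg _) (Finset.prod_le_one
    (fun k _ => halfspaceInd_nonneg _ _) fun k _ => halfspaceInd_le_one _ _)).trans (hB q)

theorem continuousAt_cellWeight {s : Finset ι} {c : ι → E × ℝ} {y : E} (hw : ContinuousAt w y)
    (hc : ∀ k ∈ s, ⟪(c k).1, y⟫ ≠ (c k).2) :
    ContinuousAt (uncurry (cellWeight w s)) (c, y) := by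
  refine ContinuousAt.mul ?_ (hw.comp (f := Prod.snd) (x := (c, y)) continuousAt_snd)
  refine tendsto_finsetProd _ fun k hk => ?_
  exact ContinuousAt.comp (f := fun x : (ι → E × ℝ) × E => (x.1 k, x.2))
    (g := fun x : (E × ℝ) × E => halfspaceInd x.1 x.2)
    (continuousAt_halfspaceInd (hc k hk)) (by fun_prop)

theorem cellWeight_update [DecidableEq ι] [Fintype ι] (c : ι → E × ℝ) (k : ι) (a : E × ℝ) (q : E) :
    cellWeight w Finset.univ (update c k a) q
      = halfspaceInd a q * cellWeight w (Finset.univ.erase k) c q := by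
  rw [cellWeight, cellWeight, ← Finset.mul_prod_erase _ _ (Finset.mem_univ k), update_self,
    mul_assoc]
  congr 2
  refine Finset.prod_congr rfl fun l hl => ?_
  rw [update_of_ne (Finset.ne_of_mem_erase hl)]

/-- General position of a point `p.1` and hyperplanes `p.2 k` with respect to `Q`. -/
def GeneralPosition (Q : Set E) (p : E × (ι → E × ℝ)) : Prop :=
  (∀ k, Separates Q (p.2 k)) ∧ (∀ k, ⟪(p.2 k).1, p.1⟫ ≠ (p.2 k).2) ∧
    ∀ k l, k ≠ l → LinearIndependent ℝ ![p.2 k, p.2 l]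

theorem isOpen_generalPosition [Finite ι] [FiniteDimensional ℝ E] (Q : Set E) :
    IsOpen {p : E × (ι → E × ℝ) | GeneralPosition Q p} := by
  have h1 : ∀ k : ι, IsOpen {p : E × (ι → E × ℝ) | Separates Q (p.2 k)} := fun k =>
    (isOpen_separates Q).preimage (by fun_prop)
  have h2 : ∀ k : ι, IsOpen {p : E × (ι → E × ℝ) | ⟪(p.2 k).1, p.1⟫ ≠ (p.2 k).2} := fun k =>
    isOpen_ne_fun (by fun_prop) (by fun_prop)
  have h3 : ∀ k l : ι, IsOpen {p : E × (ι → E × ℝ) | k ≠ l →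
      LinearIndependent ℝ ![p.2 k, p.2 l]} := fun k l => by
    by_cases hkl : k = l
    · simp [hkl]
    · simp only [ne_eq, hkl, not_false_eq_true, forall_const]
      refine (isOpen_setOfPred_linearIndependent (𝕜 := ℝ) (E := E × ℝ) (ι := Fin 2)).preimage
        (f := fun p : E × (ι → E × ℝ) => ![p.2 k, p.2 l]) ?_
      refine continuous_pi fun i => ?_
      fin_cases i
      · exact (continuous_apply k).comp continuous_snd
      · exact (continuous_apply l).comp continuous_snd
  have : {p : E × (ι → E × ℝ) | GeneralPosition Q p}
      = (⋂ k, {p : E × (ι → E × ℝ) | Separates Q (p.2 k)}) ∩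
        ((⋂ k, {p : E × (ι → E × ℝ) | ⟪(p.2 k).1, p.1⟫ ≠ (p.2 k).2}) ∩
          ⋂ k, ⋂ l, {p : E × (ι → E × ℝ) | k ≠ l → LinearIndependent ℝ ![p.2 k, p.2 l]}) := by
    ext p; simp [GeneralPosition]
  rw [this]
  exact (isOpen_iInter_of_finite h1).inter ((isOpen_iInter_of_finite h2).inter
    (isOpen_iInter_of_finite fun k => isOpen_iInter_of_finite (h3 k)))

variable [MeasurableSpace E] [BorelSpace E] (μ : Measure E)

theorem measurable_cellWeight (hw : Measurable w) (s : Finset ι) (c : ι → E × ℝ) :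
    Measurable (cellWeight w s c) :=
  (Finset.measurable_fun_prod s fun k _ => measurable_halfspaceInd (c k)).mul hw

/-- The integral of the radial field centred at `p.1` over the polyhedron given by the half-spaces
`p.2 k`, with weight `w`. -/
noncomputable def cellIntegral [Fintype ι] (w : E → ℝ) (g : ℝ → ℝ) (p : E × (ι → E × ℝ)) : E :=
  ∫ q, cellWeight w Finset.univ p.2 q • radialField g (q - p.1) ∂μ

variable [FiniteDimensional ℝ E] [μ.IsAddHaarMeasure] [Fintype ι] [Nontrivial E] {Q : Set E}

/-- Partial derivatives that exist and are continuous on an open set give C¹. In the face integral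
for `k`, separation keeps hit points off the frontier of `Q`, independence keeps them off the other
hyperplanes, and the centre condition keeps them off the singularity, almost everywhere. -/
theorem contDiffAt_cellIntegral (hQ : Convex ℝ Q) (hQc : IsCompact Q)
    (hwm : Measurable w) {B : ℝ} (hB : ∀ q, |w q| ≤ B) (hwQ : ∀ q ∉ Q, w q = 0)
    (hwc : ∀ q ∉ frontier Q, ContinuousAt w q)
    (hg : ContDiff ℝ 1 g) {K : NNReal} (hgK : LipschitzWith K g) {G : ℝ} (hG : ∀ r, |g r| ≤ G)
    (hE : 2 ≤ Module.finrank ℝ E ∨ g 0 = 0) {p₀ : E × (ι → E × ℝ)} (hp₀ : GeneralPosition Q p₀) :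
    ContDiffAt ℝ 1 (cellIntegral μ w g : E × (ι → E × ℝ) → E) p₀ := by
  classical
  have : ProperSpace E := FiniteDimensional.proper_real E
  obtain ⟨θ, hθ, ⟨T, hθT⟩, hθ0, hθ1⟩ := exists_continuous_density
  obtain ⟨R, hR⟩ := hQc.isBounded.exists_norm_le
  have hB0 : 0 ≤ B := (abs_nonneg _).trans (hB 0)
  have hwR : ∀ (s : Finset ι) (c : ι → E × ℝ) (q : E), R < ‖q‖ → cellWeight w s c q = 0 :=
    fun s c q hq => by rw [cellWeight, hwQ q fun h => hq.not_ge (hR q h), mul_zero]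
  have hFm : Measurable (radialField g : E → E) := measurable_radialField hg.continuous.measurable
  have hFc : ∀ v : E, v ≠ 0 → ContinuousAt (radialField g : E → E) v := fun v hv =>
    (contDiffAt_radialField hg hv).continuousAt
  -- The averaging directions are frozen at the normals of `p₀`; on `U` they remain transversal to
  -- the moving hyperplanes.
  set e : ι → E := fun k => (p₀.2 k).1 with he
  set h : ι → E × (ι → E × ℝ) → E → E := fun k p q =>
    cellWeight w (Finset.univ.erase k) p.2 q • radialField g (q - p.1) with hh
  have hhm : ∀ k p, StronglyMeasurable (h k p) := fun k p =>
    ((measurable_cellWeight hwm _ _).smul (hFm.comp (measurable_id.sub_const _))).stronglyMeasurable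
  have hhM : ∀ k p q, ‖h k p q‖ ≤ B * G := fun k p q => by
    rw [hh, norm_smul]
    exact mul_le_mul (abs_cellWeight_le hB _ _ _) ((norm_radialField_le g _).trans (hG _))
      (norm_nonneg _) hB0
  have hhR : ∀ k p q, R < ‖q‖ → h k p q = 0 := fun k p q hq => by
    rw [hh]; simp only; rw [hwR _ _ _ hq, zero_smul]
  set U : Set (E × (ι → E × ℝ)) :=
    {p | GeneralPosition Q p} ∩ {p | ∀ k, 0 < ⟪(p.2 k).1, e k⟫} with hU
  have hUo : IsOpen U := by
    refine (isOpen_generalPosition Q).inter ?_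
    simp only [ofPred_forall]
    exact isOpen_iInter_of_finite fun k => isOpen_lt continuous_const (by fun_prop)
  have hp₀U : p₀ ∈ U := ⟨hp₀, fun k => real_inner_self_pos.2 (hp₀.1 k).fst_ne_zero⟩
  -- joint continuity of the integrands at almost every point
  have hface : ∀ k, ∀ p ∈ U, ∀ᵐ q ∂μ,
      ContinuousAt (uncurry (h k)) (p, hitPoint (p.2 k) (e k) q) := by
    intro k p hp
    have h1 := (hp.1.1 k).ae_hitPoint_notMem_frontier μ hQ hQc.isClosed (e k)
    have h2 : ∀ᵐ q ∂μ, ∀ l, l ≠ k →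
        ⟪(p.2 l).1, hitPoint (p.2 k) (e k) q⟫ ≠ (p.2 l).2 := by
      rw [eventually_all]
      intro l
      by_cases hl : l = k
      · simp [hl]
      · filter_upwards [ae_inner_hitPoint_ne μ (hp.1.2.2 k l (Ne.symm hl)) (hp.2 k).ne'] with q hq _
          using hq
    filter_upwards [h1, h2] with q hq1 hq2
    have hne : hitPoint (p.2 k) (e k) q - p.1 ≠ 0 := by
      intro h0
      refine hp.1.2.1 k ?_
      rw [← sub_eq_zero.1 h0, hitPoint, inner_add_right, inner_smul_right, hitTime,
        div_mul_cancel₀ _ (hp.2 k).ne']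
      ring
    have h3 : ContinuousAt (fun x : (E × (ι → E × ℝ)) × E =>
        cellWeight w (Finset.univ.erase k) x.1.2 x.2) (p, hitPoint (p.2 k) (e k) q) :=
      ContinuousAt.comp (f := fun x : (E × (ι → E × ℝ)) × E => (x.1.2, x.2))
        (g := uncurry (cellWeight w (Finset.univ.erase k)))
        (continuousAt_cellWeight (hwc _ hq1) fun l hl => hq2 l (Finset.ne_of_mem_erase hl))
        (by fun_prop)
    have h4 : ContinuousAt (fun x : (E × (ι → E × ℝ)) × E => radialField g (x.2 - x.1.1))
        (p, hitPoint (p.2 k) (e k) q) :=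
      ContinuousAt.comp (f := fun x : (E × (ι → E × ℝ)) × E => x.2 - x.1.1)
        (g := (radialField g : E → E)) (hFc _ hne) (by fun_prop)
    exact h3.smul h4
  have hweight : ∀ p ∈ U, ∀ᵐ q ∂μ,
      ContinuousAt (uncurry fun p : E × (ι → E × ℝ) => cellWeight w Finset.univ p.2) (p, q) := by
    intro p hp
    have h1 : ∀ᵐ q ∂μ, ∀ k, ⟪(p.2 k).1, q⟫ ≠ (p.2 k).2 :=
      eventually_all.2 fun k => ae_inner_ne μ (hp.1.1 k).fst_ne_zero _
    have h2 := hQ.addHaar_frontier μ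
    rw [measure_eq_zero_iff_ae_notMem] at h2
    filter_upwards [h1, h2] with q hq1 hq2
    exact ContinuousAt.comp (f := fun x : (E × (ι → E × ℝ)) × E => (x.1.2, x.2))
        (g := uncurry (cellWeight w Finset.univ))
        (continuousAt_cellWeight (hwc _ hq2) fun l _ => hq1 l) (by fun_prop)
  -- the two partial derivatives
  set D₁ : E × (ι → E × ℝ) → E →L[ℝ] E := fun p =>
    -∫ v, cellWeight w Finset.univ p.2 (v + p.1) • fderiv ℝ (radialField g : E → E) v ∂μ with hD₁
  set D₂ : ι → E × (ι → E × ℝ) → E × ℝ →L[ℝ] E := fun k p =>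
    ∫ q, faceIntegrand θ (p.2 k) (e k) (h k p) q ∂μ with hD₂
  have hD₁d : ∀ p : E × (ι → E × ℝ),
      HasFDerivAt (fun z => cellIntegral μ w g (z, p.2)) (D₁ p) p.1 := fun p =>
    hasFDerivAt_integral_smul_radialField μ hg hgK hG hE (measurable_cellWeight hwm _ _)
      (abs_cellWeight_le hB _ _) (hwR _ _) p.1
  have hD₁c : ∀ p ∈ U, ContinuousAt D₁ p := fun p hp =>
    continuousAt_integral_smul_fderiv_radialField μ hg hgK hE
      (fun p => measurable_cellWeight hwm _ p.2) (fun p => abs_cellWeight_le hB _ p.2)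
      (fun p => hwR _ p.2) continuousAt_fst (hweight p hp)
  have hD₂d : ∀ p ∈ U, ∀ k,
      HasFDerivAt (fun a => cellIntegral μ w g (p.1, update p.2 k a)) (D₂ k p) (p.2 k) := by
    intro p hp k
    have h1 := hasFDerivAt_integral_halfspace μ (hhm k p) (hhM k p) (hhR k p) hθ hθT hθ0 hθ1
      (hp.2 k) ((hface k p hp).mono fun q hq =>
        hq.comp (f := fun y => (p, y)) (by fun_prop : Continuous fun y => (p, y)).continuousAt)
    refine h1.congr_of_eventuallyEq (Eventually.of_forall fun a => ?_)
    simp only [cellIntegral, cellWeight_update, mul_smul, hh]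
  have hD₂c : ∀ p ∈ U, ∀ k, ContinuousAt (D₂ k) p := fun p hp k =>
    continuousAt_integral_faceIntegrand μ (hhm k) (Eventually.of_forall (hhM k)) (hhR k) hθ hθT
      hθ0 (by fun_prop) (hp.2 k) (hface k p hp)
  set D₃ : E × (ι → E × ℝ) → (ι → E × ℝ) →L[ℝ] E := fun p =>
    ∑ k, (D₂ k p).comp (ContinuousLinearMap.proj k) with hD₃
  have hD₃d : ∀ p ∈ U, HasFDerivAt (fun c => cellIntegral μ w g (p.1, c)) (D₃ p) p.2 := by
    intro p hp
    refine hasFDerivAt_pi_of_partial (f' := fun k c => D₂ k (p.1, c)) ?_ fun k => ?_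
    · have hcont : Continuous fun c : ι → E × ℝ => (p.1, c) := by fun_prop
      filter_upwards [hcont.continuousAt.preimage_mem_nhds (hUo.mem_nhds hp)] with c hc
      exact hD₂d (p.1, c) hc
    · exact (hD₂c p hp k).comp (f := fun c => (p.1, c)) (by fun_prop)
  have hD₃c : ∀ p ∈ U, ContinuousAt D₃ p := fun p hp =>
    tendsto_finsetSum _ fun k _ => (hD₂c p hp k).clm_comp continuousAt_const
  refine contDiffAt_one_iff.2 ⟨fun p => (D₁ p).coprod (D₃ p), U, hUo.mem_nhds hp₀U,
    fun p hp => ?_, fun p hp => ?_⟩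
  · refine ContinuousAt.continuousWithinAt ?_
    have h1 : ContinuousAt (fun p => (D₁ p).comp (ContinuousLinearMap.fst ℝ E (ι → E × ℝ))) p :=
      (hD₁c p hp).clm_comp continuousAt_const
    have h2 : ContinuousAt (fun p => (D₃ p).comp (ContinuousLinearMap.snd ℝ E (ι → E × ℝ))) p :=
      (hD₃c p hp).clm_comp continuousAt_const
    refine (h1.add h2).congr (Eventually.of_forall fun p => ?_)
    ext x <;> simp
  · exact (hasStrictFDerivAt_uncurry_coprod (f := fun z c => cellIntegral μ w g (z, c))
      (f₁ := fun z c => D₁ (z, c)) (f₂ := fun z c => D₃ (z, c)) (u := p)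
      (Eventually.of_forall hD₁d)
      (by filter_upwards [hUo.mem_nhds hp] with p hp using hD₃d p hp)
      (hD₁c p hp) (hD₃c p hp)).hasFDerivAt

end CellIntegral

/-! ### The gradient of the multicenter function as cell integrals -/

section Gradient

theorem abs_iInf_sub_iInf_le {ι : Type*} [Finite ι] [Nonempty ι] {a b : ι → ℝ} {C : ℝ}
    (h : ∀ i, |a i - b i| ≤ C) : |(⨅ i, a i) - ⨅ i, b i| ≤ C := by
  have key : ∀ a b : ι → ℝ, (∀ i, |a i - b i| ≤ C) → (⨅ i, a i) - C ≤ ⨅ i, b i := by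
    intro a b h
    refine le_ciInf fun i => ?_
    have h1 := ciInf_le (Finite.bddBelow_range a) i
    linarith [(abs_le.1 (h i)).2]
  rw [abs_le]
  constructor
  · linarith [key b a fun i => by rw [abs_sub_comm]; exact h i]
  · linarith [key a b h]

theorem iInf_eq_of_forall_le {ι : Type*} [Finite ι] {a : ι → ℝ} {i : ι} (h : ∀ k, a i ≤ a k) :
    ⨅ k, a k = a i :=
  have : Nonempty ι := ⟨i⟩
  le_antisymm (ciInf_le (Finite.bddBelow_range a) i) (le_ciInf h)

theorem hasFDerivAt_comp_norm {E : Type*} [NormedAddCommGroup E] [InnerProductSpace ℝ E]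
    {f : ℝ → ℝ} {v : E} (hv : v ≠ 0) (hf : DifferentiableAt ℝ f ‖v‖) :
    HasFDerivAt (fun v : E => f ‖v‖) (innerSL ℝ (radialField (deriv f) v)) v := by
  have hn : ‖v‖ ≠ 0 := norm_ne_zero_iff.2 hv
  have h1 : HasFDerivAt (fun v : E => ‖v‖) (‖v‖⁻¹ • innerSL ℝ v) v := by
    have h2 := (hasStrictFDerivAt_norm_sq v).hasFDerivAt.sqrt (pow_ne_zero 2 hn)
    simp only [Real.sqrt_sq (norm_nonneg _)] at h2
    refine h2.congr_fderiv ?_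
    ext u
    simp
    field_simp
  have h3 := hf.hasDerivAt.comp_hasFDerivAt v h1
  refine h3.congr_fderiv ?_
  ext u
  simp [radialField]
  ring

theorem hasGradientAt_integral_of_dominated_loc_of_lip {H : Type*} [NormedAddCommGroup H]
    [InnerProductSpace ℝ H] [CompleteSpace H] {α : Type*} [MeasurableSpace α] {μ : Measure α}
    {F : H → α → ℝ} {G : α → H} {x₀ : H} {s : Set H} {bound : α → ℝ} (hs : s ∈ 𝓝 x₀)
    (hF_meas : ∀ x ∈ s, AEStronglyMeasurable (F x) μ) (hF_int : Integrable (F x₀) μ)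
    (hG_meas : AEStronglyMeasurable G μ)
    (h_lip : ∀ᵐ a ∂μ, ∀ x ∈ s, ‖F x a - F x₀ a‖ ≤ bound a * ‖x - x₀‖)
    (h_bound : Integrable bound μ)
    (h_diff : ∀ᵐ a ∂μ, HasFDerivAt (F · a) (innerSL ℝ (G a)) x₀) :
    Integrable G μ ∧ HasGradientAt (fun x => ∫ a, F x a ∂μ) (∫ a, G a ∂μ) x₀ := by
  obtain ⟨hint, hder⟩ := hasFDerivAt_integral_of_dominated_loc_of_lip' hs hF_meas hF_int
    ((innerSL ℝ : H →L[ℝ] H →L[ℝ] ℝ).continuous.comp_aestronglyMeasurable hG_meas) h_lip h_bound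
    h_diff
  have hG : Integrable G μ := by
    refine hint.norm.mono' hG_meas (Eventually.of_forall fun a => ?_)
    rw [innerSL_apply_norm]
  refine ⟨hG, ?_⟩
  rw [hasGradientAt_iff_hasFDerivAt]
  refine hder.congr_fderiv ?_
  rw [ContinuousLinearMap.integral_comp_comm (innerSL ℝ) hG]
  rfl

variable {n d : ℕ}

/-- The position of the `i`-th point and the half-spaces that cut out its Voronoi cell. -/
noncomputable def voronoiData (i : Fin n) (x : Config n d) :
    EuclideanSpace ℝ (Fin d) × ({k // k ≠ i} → EuclideanSpace ℝ (Fin d) × ℝ) :=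
  (x i, fun k => (x k - x i, (‖x k‖ ^ 2 - ‖x i‖ ^ 2) / 2))

/-- Links the half-space of `voronoiData` with being nearer to `a` than to `b`. -/
theorem inner_sub_sub_eq {E : Type*} [NormedAddCommGroup E] [InnerProductSpace ℝ E] (q a b : E) :
    ⟪b - a, q⟫ - (‖b‖ ^ 2 - ‖a‖ ^ 2) / 2 = (‖q - a‖ ^ 2 - ‖q - b‖ ^ 2) / 2 := by
  rw [norm_sub_sq_real, norm_sub_sq_real, inner_sub_left, real_inner_comm q a,
    real_inner_comm q b]
  ring

theorem cellWeight_voronoiData_of_lt {w : EuclideanSpace ℝ (Fin d) → ℝ} {x : Config n d}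
    {q : EuclideanSpace ℝ (Fin d)} {i : Fin n} (h : ∀ k, k ≠ i → ‖q - x i‖ < ‖q - x k‖) :
    cellWeight w Finset.univ (voronoiData i x).2 q = w q := by
  rw [cellWeight, Finset.prod_eq_one, one_mul]
  rintro ⟨k, hk⟩ -
  have h1 := inner_sub_sub_eq q (x i) (x k)
  have h2 := pow_le_pow_left₀ (norm_nonneg _) (h k hk).le 2
  have h3 : ⟪x k - x i, q⟫ ≤ (‖x k‖ ^ 2 - ‖x i‖ ^ 2) / 2 := by linarith
  simp [halfspaceInd, voronoiData, h3]

theorem cellWeight_voronoiData_of_gt {w : EuclideanSpace ℝ (Fin d) → ℝ} {x : Config n d}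
    {q : EuclideanSpace ℝ (Fin d)} {i k : Fin n} (hk : k ≠ i) (h : ‖q - x k‖ < ‖q - x i‖) :
    cellWeight w Finset.univ (voronoiData i x).2 q = 0 := by
  rw [cellWeight, Finset.prod_eq_zero (Finset.mem_univ ⟨k, hk⟩), zero_mul]
  have h1 := inner_sub_sub_eq q (x i) (x k)
  have h2 := pow_lt_pow_left₀ h (norm_nonneg _) two_ne_zero
  have h3 : ¬ ⟪x k - x i, q⟫ ≤ (‖x k‖ ^ 2 - ‖x i‖ ^ 2) / 2 := by
    rw [not_le]; linarith
  simp only [halfspaceInd, voronoiData]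
  rw [indicator_of_notMem]
  exact h3

/-- For almost every `q`, exactly one of finitely many distinct points is nearest to `q`. -/
theorem ae_exists_unique_nearest [Nonempty (Fin n)] {x : Config n d}
    (hx : ∀ i j, i ≠ j → x i ≠ x j) :
    ∀ᵐ q : EuclideanSpace ℝ (Fin d), ∃ i, ∀ k, k ≠ i → ‖q - x i‖ < ‖q - x k‖ := by
  have h1 : ∀ᵐ q : EuclideanSpace ℝ (Fin d), ∀ i k, k ≠ i → ‖q - x i‖ ≠ ‖q - x k‖ := by
    simp only [eventually_all]
    intro i k hki
    filter_upwards [ae_inner_ne volume (sub_ne_zero.2 (hx k i hki))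
      ((‖x k‖ ^ 2 - ‖x i‖ ^ 2) / 2)] with q hq heq
    have h2 := inner_sub_sub_eq q (x i) (x k)
    rw [heq, sub_self, zero_div] at h2
    exact hq (sub_eq_zero.1 h2)
  filter_upwards [h1] with q hq
  obtain ⟨i, hi⟩ := Finite.exists_min fun i => ‖q - x i‖
  exact ⟨i, fun k hk => (hi k).lt_of_ne (hq i k hk)⟩

/-- The gradient of the integrand of the multicenter function. -/
noncomputable def integrandGradient (w : EuclideanSpace ℝ (Fin d) → ℝ) (g : ℝ → ℝ)
    (x : Config n d) (q : EuclideanSpace ℝ (Fin d)) : Config n d :=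
  WithLp.toLp 2 fun i =>
    -(cellWeight w Finset.univ (voronoiData i x).2 q • radialField g (q - x i))

/-- Point `i` stays strictly nearest near `x`, so monotonicity of `f` reduces the minimum to one
term. In the claimed gradient the other blocks vanish because `q` lies outside their cells. -/
theorem hasFDerivAt_integrand {w : EuclideanSpace ℝ (Fin d) → ℝ} {f : ℝ → ℝ}
    (hf : Differentiable ℝ f) (hmono : StrictMonoOn f (Ici 0)) {x : Config n d}
    {q : EuclideanSpace ℝ (Fin d)} {i : Fin n} (hi : ∀ k, k ≠ i → ‖q - x i‖ < ‖q - x k‖)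
    (hq : q ≠ x i) :
    HasFDerivAt (fun y : Config n d => (⨅ k, f ‖q - y k‖) * w q)
      (innerSL ℝ (integrandGradient w (deriv f) x q)) x := by
  have hnorm : ∀ k, Continuous fun y : Config n d => ‖q - y k‖ := fun k => by fun_prop
  have hev : ∀ᶠ y in 𝓝 x, (⨅ k, f ‖q - y k‖) * w q = f ‖q - y i‖ * w q := by
    have : ∀ᶠ y : Config n d in 𝓝 x, ∀ k, k ≠ i → ‖q - y i‖ < ‖q - y k‖ := by
      rw [eventually_all]
      intro k
      by_cases hk : k = i
      · simp [hk]
      · filter_upwards [(hnorm i).continuousAt.eventually_lt (hnorm k).continuousAt (hi k hk)]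
          with y hy _ using hy
    filter_upwards [this] with y hy
    rw [iInf_eq_of_forall_le (i := i) fun k => ?_]
    by_cases hk : k = i
    · rw [hk]
    · exact hmono.monotoneOn (norm_nonneg _) (norm_nonneg _) (hy k hk).le
  refine HasFDerivAt.congr_of_eventuallyEq ?_ hev
  have h1 : HasFDerivAt (fun y : Config n d => q - y i)
      (-(PiLp.proj 2 (fun _ : Fin n => EuclideanSpace ℝ (Fin d)) i : Config n d →L[ℝ] _)) x :=
    (PiLp.proj 2 (𝕜 := ℝ) (fun _ : Fin n => EuclideanSpace ℝ (Fin d)) i).hasFDerivAt.const_sub q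
  have h2 := ((hasFDerivAt_comp_norm (sub_ne_zero.2 hq) (hf _)).comp x h1).mul_const (w q)
  refine h2.congr_fderiv ?_
  ext u
  rw [innerSL_apply_apply, PiLp.inner_apply, Finset.sum_eq_single i]
  · simp only [integrandGradient, cellWeight_voronoiData_of_lt hi]
    simp [inner_smul_left]
  · intro k _ hk
    simp [integrandGradient, cellWeight_voronoiData_of_gt (Ne.symm hk) (hi k hk)]
  · simp

theorem hasGradientAt_integral_iInf [Nonempty (Fin n)] [Nontrivial (EuclideanSpace ℝ (Fin d))]
    {w : EuclideanSpace ℝ (Fin d) → ℝ} (hwm : Measurable w) {B R : ℝ} (hB : ∀ q, |w q| ≤ B)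
    (hR : ∀ q, R < ‖q‖ → w q = 0) {f : ℝ → ℝ} (hf : ContDiff ℝ 1 f)
    (hmono : StrictMonoOn f (Ici 0)) {x : Config n d} (hx : ∀ i j, i ≠ j → x i ≠ x j) :
    HasGradientAt (fun y : Config n d => ∫ q, (⨅ k, f ‖q - y k‖) * w q)
      (WithLp.toLp 2 fun i => -cellIntegral volume w (deriv f) (voronoiData i x)) x := by
  have hB0 : 0 ≤ B := (abs_nonneg _).trans (hB 0)
  -- Bounds every distance `‖q - y k‖` with `‖q‖ ≤ R` and `y` in the unit ball about `x`.
  set r := R + ‖x‖ + 1 with hr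
  obtain ⟨C, hC⟩ := (isCompact_Icc (a := (0 : ℝ)) (b := r)).exists_bound_of_continuousOn
    (hf.continuous_deriv le_rfl).continuousOn
  have hLip : ∀ s ∈ Icc 0 r, ∀ t ∈ Icc 0 r, |f t - f s| ≤ C * |t - s| := fun s hs t ht =>
    (convex_Icc 0 r).norm_image_sub_le_of_norm_deriv_le
      (fun u _ => hf.differentiable one_ne_zero u) hC hs ht
  have hmeas : ∀ y : Config n d, Measurable fun q => (⨅ k, f ‖q - y k‖) * w q := fun y => by
    refine Measurable.mul (Measurable.iInf fun k => ?_) hwm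
    exact hf.continuous.measurable.comp (by fun_prop)
  have hdist : ∀ y ∈ Metric.ball x 1, ∀ q, ‖q‖ ≤ R → ∀ k, ‖q - y k‖ ∈ Icc 0 r := by
    intro y hy q hq k
    refine ⟨norm_nonneg _, ?_⟩
    have h1 : ‖y k‖ ≤ ‖y‖ := PiLp.norm_apply_le y k
    have h2 : ‖y‖ ≤ ‖x‖ + 1 := by
      have := norm_le_norm_add_norm_sub' y x
      rw [mem_ball_iff_norm] at hy
      linarith
    linarith [norm_sub_le q (y k)]
  have hae := ae_exists_unique_nearest hx
  have hne : ∀ᵐ q : EuclideanSpace ℝ (Fin d), ∀ i, q ≠ x i :=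
    eventually_all.2 fun i => Measure.ae_ne volume (x i)
  have hbd : ∀ c : ℝ, Integrable ((Metric.closedBall (0 : EuclideanSpace ℝ (Fin d)) R).indicator
      fun _ => c) := fun c => (integrable_indicator_iff measurableSet_closedBall).2
    (integrableOn_const measure_closedBall_lt_top.ne)
  have hGm : AEStronglyMeasurable (integrandGradient w (deriv f) x) volume := by
    have h1 : StronglyMeasurable fun q : EuclideanSpace ℝ (Fin d) => fun i : Fin n =>
        -(cellWeight w Finset.univ (voronoiData i x).2 q • radialField (deriv f) (q - x i)) := by
      refine (measurable_pi_lambda _ fun i => ?_).stronglyMeasurable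
      exact ((measurable_cellWeight hwm _ _).smul ((measurable_radialField
        (measurable_deriv f)).comp (measurable_id.sub_const _))).neg
    exact ((PiLp.continuous_toLp 2 _).comp_stronglyMeasurable h1).aestronglyMeasurable
  -- If `R` is negative the interval `Icc 0 r` may be empty, so the sign of `C` is known only once
  -- some `q` with `‖q‖ ≤ R` exists.
  have hC0 : ∀ q : EuclideanSpace ℝ (Fin d), ‖q‖ ≤ R → 0 ≤ C := fun q hq =>
    (norm_nonneg _).trans (hC 0 ⟨le_rfl, by linarith [norm_nonneg x, norm_nonneg q]⟩)
  have hmain := hasGradientAt_integral_of_dominated_loc_of_lip (μ := volume)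
    (F := fun (y : Config n d) q => (⨅ k, f ‖q - y k‖) * w q)
    (G := integrandGradient w (deriv f) x) (x₀ := x)
    (s := Metric.ball x 1)
    (bound := (Metric.closedBall 0 R).indicator fun _ => C * B)
    (Metric.ball_mem_nhds x one_pos) (fun y _ => (hmeas y).aestronglyMeasurable) ?_ hGm ?_
    (hbd _) ?_
  · obtain ⟨hG, hder⟩ := hmain
    convert hder using 1
    ext1 i
    have h1 := (PiLp.proj 2 (𝕜 := ℝ) (fun _ : Fin n => EuclideanSpace ℝ (Fin d))
      i).integral_comp_comm hG
    simp only [PiLp.proj_apply] at h1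
    rw [← h1]
    simp only [integrandGradient, integral_neg]
    rfl
  · refine IntegrableOn.integrable_of_forall_notMem_eq_zero (s := Metric.closedBall 0 R)
      (Measure.integrableOn_of_bounded (M := (|f 0| + C * r) * B) measure_closedBall_lt_top.ne
        (hmeas x).aestronglyMeasurable ?_) fun q hq => ?_
    · filter_upwards [ae_restrict_mem measurableSet_closedBall] with q hq
      have hq' : ‖q‖ ≤ R := by simpa using hq
      obtain ⟨i, hi⟩ := Finite.exists_min fun i => ‖q - x i‖
      have hm := hdist x (Metric.mem_ball_self one_pos) q hq' i
      rw [iInf_eq_of_forall_le (i := i) fun k =>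
        hmono.monotoneOn (norm_nonneg _) (norm_nonneg _) (hi k), norm_mul]
      refine mul_le_mul ?_ (hB q) (abs_nonneg _) (by
        have := hC0 q hq'
        have : 0 ≤ r := hm.1.trans hm.2
        positivity)
      have h1 := hLip 0 ⟨le_rfl, hm.1.trans hm.2⟩ _ hm
      rw [sub_zero, abs_of_nonneg hm.1] at h1
      have h2 : C * ‖q - x i‖ ≤ C * r := by have := hC0 q hq'; gcongr; exact hm.2
      have h3 := abs_add_le (f ‖q - x i‖ - f 0) (f 0)
      rw [sub_add_cancel] at h3
      rw [Real.norm_eq_abs]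
      linarith
    · rw [hR q (by simpa using hq), mul_zero]
  · refine Eventually.of_forall fun q y hy => ?_
    by_cases hq : q ∈ Metric.closedBall 0 R
    · have hq' : ‖q‖ ≤ R := by simpa using hq
      have hC0' := hC0 q hq'
      rw [← sub_mul, norm_mul, indicator_of_mem hq, mul_right_comm]
      refine mul_le_mul (abs_iInf_sub_iInf_le fun k => ?_) (hB q) (abs_nonneg _) (by positivity)
      refine (hLip _ (hdist x (Metric.mem_ball_self one_pos) q hq' k) _
        (hdist y hy q hq' k)).trans ?_
      gcongr
      refine (abs_norm_sub_norm_le _ _).trans ?_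
      rw [sub_sub_sub_cancel_left, norm_sub_rev]
      exact PiLp.norm_apply_le (y - x) k
    · rw [indicator_of_notMem hq, hR q (by simpa using hq), mul_zero, mul_zero, sub_self,
        norm_zero, zero_mul]
  · filter_upwards [hae, hne] with q ⟨i, hi⟩ hq
    exact hasFDerivAt_integrand (hf.differentiable one_ne_zero) hmono hi (hq i)

end Gradient

/-! ### Extending `f` to the line and cutting off its derivative -/

section Extension

theorem eq_add_integral_derivWithin_Ici {u : ℝ → ℝ} (hu : ContDiffOn ℝ 1 u (Ici 0)) {r : ℝ}
    (hr : 0 ≤ r) : u r = u 0 + ∫ s in (0 : ℝ)..r, derivWithin u (Ici 0) (max s 0) := by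
  have hc : ContinuousOn (derivWithin u (Ici 0)) (Ici 0) :=
    hu.continuousOn_derivWithin (uniqueDiffOn_Ici 0) le_rfl
  have hc' : Continuous fun s : ℝ => derivWithin u (Ici 0) (max s 0) :=
    hc.comp_continuous (by fun_prop) fun s => le_max_right s 0
  have := intervalIntegral.integral_eq_sub_of_hasDeriv_right_of_le hr
    (hu.continuousOn.mono Icc_subset_Ici_self) (fun s hs => ?_) (hc'.intervalIntegrable 0 r)
  · rw [this]; ring
  · rw [max_eq_left hs.1.le]
    exact ((hu.differentiableOn one_ne_zero s hs.1.le).hasDerivWithinAt).mono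
      fun t ht => hs.1.le.trans (le_of_lt ht)

/-- The second derivative, continued to negative arguments by its value at `0`, is integrated twice.
-/
theorem exists_contDiff_eqOn_Ici {f : ℝ → ℝ} (hf : ContDiffOn ℝ 2 f (Ici 0)) :
    ∃ F : ℝ → ℝ, ContDiff ℝ 2 F ∧ EqOn F f (Ici 0) := by
  set g := derivWithin f (Ici 0) with hg
  have hgd : ContDiffOn ℝ 1 g (Ici 0) := hf.derivWithin (uniqueDiffOn_Ici 0) (by norm_num)
  set k : ℝ → ℝ := fun s => derivWithin g (Ici 0) (max s 0) with hk
  have hkc : Continuous k :=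
    (hgd.continuousOn_derivWithin (uniqueDiffOn_Ici 0) le_rfl).comp_continuous (by fun_prop)
      fun s => le_max_right s 0
  set G : ℝ → ℝ := fun r => g 0 + ∫ s in (0 : ℝ)..r, k s with hG
  have hGd : ∀ r, HasDerivAt G (k r) r := fun r =>
    (hkc.integral_hasStrictDerivAt 0 r).hasDerivAt.const_add _
  have hG1 : ContDiff ℝ 1 G := by
    rw [contDiff_one_iff_deriv, show deriv G = k from funext fun r => (hGd r).deriv]
    exact ⟨fun r => (hGd r).differentiableAt, hkc⟩
  set F : ℝ → ℝ := fun r => f 0 + ∫ s in (0 : ℝ)..r, G s with hF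
  have hFd : ∀ r, HasDerivAt F (G r) r := fun r =>
    (hG1.continuous.integral_hasStrictDerivAt 0 r).hasDerivAt.const_add _
  refine ⟨F, ?_, fun r hr => ?_⟩
  · rw [show (2 : WithTop ℕ∞) = 1 + 1 by norm_num, contDiff_succ_iff_deriv,
      show deriv F = G from funext fun r => (hFd r).deriv]
    exact ⟨fun r => (hFd r).differentiableAt, by simp, hG1⟩
  · rw [eq_add_integral_derivWithin_Ici (hf.of_le (by norm_num)) hr, hF]
    simp only
    congr 1
    refine intervalIntegral.integral_congr fun s hs => ?_
    rw [uIcc_of_le hr] at hs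
    rw [max_eq_left hs.1]
    exact (eq_add_integral_derivWithin_Ici hgd hs.1).symm

/-- Distances from points of `Q` to nearby configurations are bounded, so cutting `g` off far out
changes no cell integral but supplies global bounds. -/
theorem exists_lipschitz_bounded_eqOn {g : ℝ → ℝ} (hg : ContDiff ℝ 1 g) (ρ : ℝ) :
    ∃ h : ℝ → ℝ, ContDiff ℝ 1 h ∧ (∃ K, LipschitzWith K h) ∧ (∃ G, ∀ r, |h r| ≤ G) ∧
      ∀ r, |r| ≤ ρ → h r = g r := by
  let b : ContDiffBump (0 : ℝ) := ⟨|ρ| + 1, |ρ| + 2, by positivity, by linarith⟩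
  have hd : ContDiff ℝ 1 fun r => b r * g r := b.contDiff.mul hg
  have hcs : HasCompactSupport fun r => b r * g r := b.hasCompactSupport.mul_right
  refine ⟨fun r => b r * g r, hd, hd.lipschitzWith_of_hasCompactSupport hcs one_ne_zero,
    hcs.exists_bound_of_continuous hd.continuous, fun r hr => ?_⟩
  have hr' : |r| ≤ |ρ| + 1 := by linarith [le_abs_self ρ]
  simp only
  rw [b.one_of_mem_closedBall (by simpa [b] using hr'), one_mul]

end Extension

/-! ### The density as a weight vanishing off `Q` -/

section Weight

variable {E : Type*} [NormedAddCommGroup E] {φ : E → ℝ} {Q : Set E}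

theorem continuousAt_indicator_of_notMem_frontier (hφ : ContinuousOn φ Q) {q : E}
    (hq : q ∉ frontier Q) : ContinuousAt (Q.indicator φ) q := by
  by_cases hqi : q ∈ interior Q
  · have hn : Q ∈ 𝓝 q := mem_interior_iff_mem_nhds.1 hqi
    refine (hφ.continuousAt hn).congr ?_
    filter_upwards [hn] with y hy
    rw [indicator_of_mem hy]
  · have hqc : q ∉ closure Q := fun h => hq ⟨h, hqi⟩
    refine (continuousAt_const (y := (0 : ℝ))).congr ?_
    filter_upwards [isClosed_closure.isOpen_compl.mem_nhds hqc] with y hy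
    rw [indicator_of_notMem fun h => hy (subset_closure h)]

theorem exists_abs_indicator_le (hQ : IsCompact Q) (hφ : ContinuousOn φ Q) :
    ∃ B, ∀ q, |Q.indicator φ q| ≤ B := by
  obtain ⟨B, hB⟩ := hQ.exists_bound_of_continuousOn hφ
  refine ⟨max B 0, fun q => ?_⟩
  by_cases hq : q ∈ Q
  · rw [indicator_of_mem hq]
    exact (hB q hq).trans (le_max_left _ _)
  · rw [indicator_of_notMem hq, abs_zero]
    exact le_max_right _ _

theorem measurable_indicator_of_continuousOn [MeasurableSpace E] [BorelSpace E]
    (hQ : MeasurableSet Q) (hφ : ContinuousOn φ Q) : Measurable (Q.indicator φ) := by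
  classical
  rw [← piecewise_eq_indicator]
  exact hφ.measurable_piecewise continuousOn_const hQ

theorem nonempty_interior_of_setIntegral_ne_zero [NormedSpace ℝ E] [MeasurableSpace E]
    [BorelSpace E] [FiniteDimensional ℝ E] (μ : Measure E) [μ.IsAddHaarMeasure]
    (hQ : Convex ℝ Q) (h : ∫ q in Q, φ q ∂μ ≠ 0) : (interior Q).Nonempty := by
  by_contra hne
  rw [not_nonempty_iff_eq_empty] at hne
  have h0 : μ Q = 0 := measure_mono_null
    (fun q hq => (⟨subset_closure hq, by simp [hne]⟩ : q ∈ frontier Q)) (hQ.addHaar_frontier μ)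
  exact h (by rw [Measure.restrict_eq_zero.2 h0, integral_zero_measure])

end Weight

/-! ### Bisectors of distinct points are in general position -/

section VoronoiPosition

variable {n d : ℕ}

theorem contDiff_voronoiData (i : Fin n) : ContDiff ℝ 1 (voronoiData i : Config n d → _) := by
  have h : ∀ k : Fin n, ContDiff ℝ 1 fun x : Config n d => x k := fun k => by fun_prop
  refine (h i).prodMk (contDiff_pi.2 fun k => ?_)
  exact ((h k).sub (h i)).prodMk ((((h k).norm_sq ℝ).sub ((h i).norm_sq ℝ)).div_const 2)

/-- With `u = b - a`, `v = c - a`, a relation gives `s • u + t • v = 0` and `s * ‖u‖ ^ 2 + t * ‖v‖ ^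
2 = 0`. Comparing norms yields `t * (t + s) = 0`, and `t = -s` would give `s • (b - c) = 0`.
Collinear points are covered: their bisectors are parallel but distinct. -/
theorem linearIndependent_bisector {E : Type*} [NormedAddCommGroup E] [InnerProductSpace ℝ E]
    {a b c : E} (hab : a ≠ b) (hac : a ≠ c) (hbc : b ≠ c) :
    LinearIndependent ℝ ![((b - a, (‖b‖ ^ 2 - ‖a‖ ^ 2) / 2) : E × ℝ),
      (c - a, (‖c‖ ^ 2 - ‖a‖ ^ 2) / 2)] := by
  rw [LinearIndependent.pair_iff]
  intro s t hst
  obtain ⟨h1, h2⟩ := Prod.ext_iff.1 hst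
  simp only [Prod.smul_mk, Prod.mk_add_mk, Prod.fst_zero, Prod.snd_zero, smul_eq_mul] at h1 h2
  have hu : 0 < ‖b - a‖ ^ 2 := by
    have := norm_pos_iff.2 (sub_ne_zero.2 hab.symm); positivity
  have hv : 0 < ‖c - a‖ ^ 2 := by
    have := norm_pos_iff.2 (sub_ne_zero.2 hac.symm); positivity
  have e1 : ‖b‖ ^ 2 - ‖a‖ ^ 2 = ‖b - a‖ ^ 2 + 2 * ⟪b - a, a⟫ := by
    have := norm_add_sq_real (b - a) a
    rw [sub_add_cancel] at this; linarith
  have e2 : ‖c‖ ^ 2 - ‖a‖ ^ 2 = ‖c - a‖ ^ 2 + 2 * ⟪c - a, a⟫ := by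
    have := norm_add_sq_real (c - a) a
    rw [sub_add_cancel] at this; linarith
  have h3 : s * ⟪b - a, a⟫ + t * ⟪c - a, a⟫ = 0 := by
    rw [← real_inner_smul_left, ← real_inner_smul_left, ← inner_add_left, h1, inner_zero_left]
  have h4 : s * ‖b - a‖ ^ 2 + t * ‖c - a‖ ^ 2 = 0 := by
    rw [e1, e2] at h2; linarith
  have h5 : s ^ 2 * ‖b - a‖ ^ 2 = t ^ 2 * ‖c - a‖ ^ 2 := by
    have h6 : s • (b - a) = -(t • (c - a)) := eq_neg_of_add_eq_zero_left h1
    have h7 := congrArg (fun v => ‖v‖ ^ 2) h6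
    simpa only [norm_neg, norm_smul, mul_pow, Real.norm_eq_abs, sq_abs] using h7
  have h6 : t * (t + s) * ‖c - a‖ ^ 2 = 0 := by linear_combination s * h4 - h5
  rcases mul_eq_zero.1 h6 with h7 | h7
  · rcases mul_eq_zero.1 h7 with ht | hts
    · refine ⟨?_, ht⟩
      rw [ht, zero_mul, add_zero] at h4
      exact (mul_eq_zero.1 h4).resolve_right hu.ne'
    · have ht : t = -s := by linarith
      rw [ht] at h1
      have h8 : s • (b - c) = 0 := by rw [← h1]; module
      have hs := (smul_eq_zero.1 h8).resolve_right (sub_ne_zero.2 hbc)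
      exact ⟨hs, by rw [ht, hs, neg_zero]⟩
  · exact absurd h7 hv.ne'

/-- The bisector strictly separates `x i` from `x k`. Both may lie on the boundary of `Q`, but a
convex set with nonempty interior lies in the closure of that interior, so interior points are
separated too. -/
theorem generalPosition_voronoiData {Q : Set (EuclideanSpace ℝ (Fin d))} (hQ : Convex ℝ Q)
    (hQi : (interior Q).Nonempty) {x : Config n d} (hxQ : ∀ i, x i ∈ Q)
    (hx : ∀ i j, i ≠ j → x i ≠ x j) (i : Fin n) : GeneralPosition Q (voronoiData i x) := by
  have hcl : ∀ k, x k ∈ closure (interior Q) := fun k => by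
    rw [hQ.closure_interior_eq_closure_of_nonempty_interior hQi]
    exact subset_closure (hxQ k)
  have hpos : ∀ k, k ≠ i → 0 < ‖x i - x k‖ ^ 2 := fun k hk => by
    have := norm_pos_iff.2 (sub_ne_zero.2 (hx i k hk.symm)); positivity
  have hlt : ∀ k, k ≠ i → ⟪x k - x i, x i⟫ < (‖x k‖ ^ 2 - ‖x i‖ ^ 2) / 2 := fun k hk => by
    have h1 := inner_sub_sub_eq (x i) (x i) (x k)
    rw [sub_self, norm_zero] at h1
    linarith [hpos k hk]
  have hgt : ∀ k, k ≠ i → (‖x k‖ ^ 2 - ‖x i‖ ^ 2) / 2 < ⟪x k - x i, x k⟫ := fun k hk => by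
    have h1 := inner_sub_sub_eq (x k) (x i) (x k)
    rw [sub_self, norm_zero, norm_sub_rev] at h1
    linarith [hpos k hk]
  have hin : ∀ a : EuclideanSpace ℝ (Fin d), Continuous fun q => ⟪a, q⟫ := fun a => by fun_prop
  refine ⟨fun ⟨k, hk⟩ => ⟨?_, ?_⟩, fun ⟨k, hk⟩ => (hlt k hk).ne, fun ⟨k, hk⟩ ⟨l, hl⟩ hkl => ?_⟩
  · obtain ⟨q, hq1, hq2⟩ := mem_closure_iff.1 (hcl i) _
      (isOpen_lt (hin (x k - x i)) continuous_const) (hlt k hk)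
    exact ⟨q, hq2, hq1⟩
  · obtain ⟨q, hq1, hq2⟩ := mem_closure_iff.1 (hcl k) _
      (isOpen_lt continuous_const (hin (x k - x i))) (hgt k hk)
    exact ⟨q, hq2, hq1⟩
  · exact linearIndependent_bisector (hx i k hk.symm) (hx i l hl.symm)
      (hx k l fun h => hkl (Subtype.ext h))

end VoronoiPosition

/-! ### Dimension one: the unit radial field is the sign function -/

section Line

theorem integral_mul_sign_sub {ψ : ℝ → ℝ} (hψ : Continuous ψ) {a b z : ℝ} (hz : z ∈ Icc a b) :
    ∫ t in a..b, SignType.sign (t - z) * ψ t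
      = (∫ t in a..b, ψ t) - 2 * ∫ t in a..z, ψ t := by
  have hi : ∀ s t : ℝ, IntervalIntegrable ψ volume s t := fun s t => hψ.intervalIntegrable s t
  have e1 : EqOn (fun t => -ψ t) (fun t => SignType.sign (t - z) * ψ t) (Ioo a z) := fun t ht => by
    simp [sign_neg (sub_neg.2 ht.2)]
  have e2 : EqOn ψ (fun t => SignType.sign (t - z) * ψ t) (Ioo z b) := fun t ht => by
    simp [sign_pos (sub_pos.2 ht.1)]
  have i1 : IntervalIntegrable (fun t => SignType.sign (t - z) * ψ t) volume a z :=
    (hi a z).neg.congr_uIoo (by rwa [uIoo_of_le hz.1])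
  have i2 : IntervalIntegrable (fun t => SignType.sign (t - z) * ψ t) volume z b :=
    (hi z b).congr_uIoo (by rwa [uIoo_of_le hz.2])
  rw [← intervalIntegral.integral_add_adjacent_intervals i1 i2,
    ← intervalIntegral.integral_congr_Ioo_of_le hz.1 e1,
    ← intervalIntegral.integral_congr_Ioo_of_le hz.2 e2, intervalIntegral.integral_neg,
    ← intervalIntegral.integral_add_adjacent_intervals (hi a z) (hi z b)]
  ring

/-- The isometric embedding of `ℝ` onto the Euclidean line. -/
noncomputable def toLine (t : ℝ) : EuclideanSpace ℝ (Fin 1) := WithLp.toLp 2 fun _ => t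

theorem toLine_apply_zero (q : EuclideanSpace ℝ (Fin 1)) : toLine (q 0) = q := by
  ext i
  rw [Subsingleton.elim i 0]
  rfl

theorem continuous_toLine : Continuous toLine := by
  unfold toLine
  fun_prop

theorem norm_toLine (t : ℝ) : ‖toLine t‖ = |t| := by
  simp [toLine, EuclideanSpace.norm_eq, Real.sqrt_sq_eq_abs]

theorem radialField_one_toLine (t : ℝ) :
    radialField (fun _ => 1) (toLine t) = (SignType.sign t : ℝ) • toLine 1 := by
  ext i
  rw [radialField, norm_toLine]
  simp only [PiLp.smul_apply, toLine, smul_eq_mul]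
  rcases lt_trichotomy t 0 with h | rfl | h
  · rw [sign_neg h, abs_of_neg h]
    have := h.ne
    field_simp
    simp
  · simp
  · rw [sign_pos h, abs_of_pos h]
    field_simp
    simp

theorem integral_eq_integral_toLine {V : Type*} [NormedAddCommGroup V] [NormedSpace ℝ V]
    (G : EuclideanSpace ℝ (Fin 1) → V) : ∫ q, G q = ∫ t, G (toLine t) := by
  have h := ((volume_preserving_funUnique (Fin 1) ℝ).comp
    (EuclideanSpace.volume_preserving_symm_measurableEquiv_toLp (Fin 1))).integral_comp
    ((MeasurableEquiv.measurableEmbedding _).comp (MeasurableEquiv.measurableEmbedding _))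
    fun t => G (toLine t)
  rw [← h]
  congr 1 with q
  exact congrArg G (toLine_apply_zero q).symm

/-- On the line, the integral of the unit radial field over a segment `Q` agrees on `Q` with a
continuously differentiable function of the centre. -/
theorem exists_contDiff_integral_radialField_one {Q : Set (EuclideanSpace ℝ (Fin 1))}
    (hQ : Convex ℝ Q) (hQc : IsCompact Q) {φ : EuclideanSpace ℝ (Fin 1) → ℝ}
    (hφ : ContinuousOn φ Q) :
    ∃ Ψ : EuclideanSpace ℝ (Fin 1) → EuclideanSpace ℝ (Fin 1), ContDiff ℝ 1 Ψ ∧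
      ∀ z ∈ Q, ∫ q, Q.indicator φ q • radialField (fun _ => 1) (q - z) = Ψ z := by
  rcases Q.eq_empty_or_nonempty with rfl | hne
  · exact ⟨0, contDiff_const, by simp⟩
  have hcoord : Continuous fun q : EuclideanSpace ℝ (Fin 1) => q 0 := by fun_prop
  set A := (fun q : EuclideanSpace ℝ (Fin 1) => q 0) '' Q with hA
  have hAc : IsCompact A := hQc.image hcoord
  have hAconn : IsConnected A := ⟨hne.image _, hQ.isPreconnected.image _ hcoord.continuousOn⟩
  have hmem : ∀ t, toLine t ∈ Q ↔ t ∈ A := fun t => by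
    constructor
    · exact fun h => ⟨_, h, rfl⟩
    · rintro ⟨q, hq, rfl⟩
      rwa [toLine_apply_zero]
  have hAI := eq_Icc_of_connected_compact hAconn hAc
  set a := sInf A
  set b := sSup A
  have hab : a ≤ b := nonempty_Icc.1 (hAI ▸ hAconn.nonempty)
  have hcont : ContinuousOn (fun t => φ (toLine t)) (Icc a b) :=
    hφ.comp continuous_toLine.continuousOn fun t ht => (hmem t).2 (hAI ▸ ht)
  -- Extending `φ` by its endpoint values keeps the primitive C¹ across the ends of the segment;
  -- extending by zero could create a kink there.
  set ψ : ℝ → ℝ := IccExtend hab ((Icc a b).domRestrict fun t => φ (toLine t)) with hψ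
  have hψc : Continuous ψ := (continuousOn_iff_continuous_domRestrict.1 hcont).Icc_extend'
  refine ⟨fun z => ((∫ t in a..b, ψ t) - 2 * ∫ t in a..(z 0), ψ t) • toLine 1, ?_, fun z hz => ?_⟩
  · have h1 : ContDiff ℝ 1 fun r => ∫ t in a..r, ψ t := by
      have hd : ∀ r, HasDerivAt (fun r => ∫ t in a..r, ψ t) (ψ r) r := fun r =>
        (hψc.integral_hasStrictDerivAt a r).hasDerivAt
      rw [contDiff_one_iff_deriv, show deriv (fun r => ∫ t in a..r, ψ t) = ψ from
        funext fun r => (hd r).deriv]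
      exact ⟨fun r => (hd r).differentiableAt, hψc⟩
    have h2 : ContDiff ℝ 1 fun z : EuclideanSpace ℝ (Fin 1) => z 0 := by fun_prop
    exact (contDiff_const.sub (contDiff_const.mul (h1.comp h2))).smul contDiff_const
  · have hzI : z 0 ∈ Icc a b := hAI ▸ ⟨z, hz, rfl⟩
    rw [integral_eq_integral_toLine]
    have h1 : ∀ t, Q.indicator φ (toLine t) • radialField (fun _ => 1) (toLine t - z)
        = (Icc a b).indicator (fun t => SignType.sign (t - z 0) * ψ t) t • toLine 1 := by
      intro t
      by_cases ht : t ∈ Icc a b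
      · have hsub : toLine t - z = toLine (t - z 0) := by
          conv_lhs => rw [← toLine_apply_zero z]
          rfl
        rw [indicator_of_mem ((hmem t).2 (hAI ▸ ht)), indicator_of_mem ht, hsub,
          radialField_one_toLine, smul_smul, hψ, IccExtend_of_mem _ _ ht, mul_comm]
        rfl
      · rw [indicator_of_notMem ht, indicator_of_notMem fun h => ht (hAI ▸ (hmem t).1 h),
          zero_smul, zero_smul]
    simp only [h1]
    rw [integral_smul_const, integral_indicator measurableSet_Icc, integral_Icc_eq_integral_Ioc,
      ← intervalIntegral.integral_of_le hab, integral_mul_sign_sub hψc hzI]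

end Line

/-! ### Dependence of the cell integral on the radial profile -/

section CellIntegralAlgebra

variable {E : Type*} [NormedAddCommGroup E] [InnerProductSpace ℝ E] [MeasurableSpace E]
  {μ : Measure E} {ι : Type*} [Fintype ι] {w : E → ℝ} {g g₁ g₂ : ℝ → ℝ}

theorem cellIntegral_congr {p : E × (ι → E × ℝ)}
    (h : ∀ q, w q ≠ 0 → g₁ ‖q - p.1‖ = g₂ ‖q - p.1‖) :
    cellIntegral μ w g₁ p = cellIntegral μ w g₂ p := by
  unfold cellIntegral
  congr 1 with q
  by_cases hq : w q = 0
  · simp [cellWeight, hq]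
  · rw [radialField, radialField, h q hq]

variable [BorelSpace E] [FiniteDimensional ℝ E] [μ.IsAddHaarMeasure]

theorem integrable_cellWeight_smul_radialField (hw : Measurable w) {B R : ℝ} (hB : ∀ q, |w q| ≤ B)
    (hR : ∀ q, R < ‖q‖ → w q = 0) (hg : Measurable g) {G : ℝ} (hG : ∀ r, |g r| ≤ G)
    (c : ι → E × ℝ) (z : E) :
    Integrable (fun q => cellWeight w Finset.univ c q • radialField g (q - z)) μ := by
  have : ProperSpace E := FiniteDimensional.proper_real E
  refine IntegrableOn.integrable_of_forall_notMem_eq_zero (s := Metric.closedBall 0 R)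
    (Measure.integrableOn_of_bounded (M := B * G) measure_closedBall_lt_top.ne
    (Measurable.aestronglyMeasurable ?_) (Eventually.of_forall fun q => ?_)) fun q hq => ?_
  · exact (measurable_cellWeight hw _ _).smul
      ((measurable_radialField hg).comp (measurable_id.sub_const z))
  · rw [norm_smul]
    exact mul_le_mul (abs_cellWeight_le hB _ _ q) ((norm_radialField_le g _).trans (hG _))
      (norm_nonneg _) ((abs_nonneg _).trans (hB 0))
  · rw [cellWeight, hR q (by simpa using hq), mul_zero, zero_smul]

theorem cellIntegral_sub_smul (hw : Measurable w) {B R : ℝ} (hB : ∀ q, |w q| ≤ B)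
    (hR : ∀ q, R < ‖q‖ → w q = 0) (hg₁ : Measurable g₁) {G₁ : ℝ} (hG₁ : ∀ r, |g₁ r| ≤ G₁)
    (hg₂ : Measurable g₂) {G₂ : ℝ} (hG₂ : ∀ r, |g₂ r| ≤ G₂) (a : ℝ) (p : E × (ι → E × ℝ)) :
    cellIntegral μ w (fun r => g₁ r - a * g₂ r) p
      = cellIntegral μ w g₁ p - a • cellIntegral μ w g₂ p := by
  unfold cellIntegral
  have h1 := integrable_cellWeight_smul_radialField (μ := μ) hw hB hR hg₁ hG₁ p.2 p.1
  have h2 : Integrable (fun q => a • cellWeight w Finset.univ p.2 q • radialField g₂ (q - p.1)) μ :=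
    (integrable_cellWeight_smul_radialField hw hB hR hg₂ hG₂ p.2 p.1).smul a
  rw [← integral_smul, ← integral_sub h1 h2]
  congr 1 with q
  simp only [radialField]
  rw [sub_div, mul_div_assoc]
  module

end CellIntegralAlgebra

/-! ### Cell integrals along Voronoi data, and the theorem -/

section Voronoi

variable {n d : ℕ}

/-- The ball of radius `δ` about `x i` lies inside its cell, so a profile supported there does not
see the half-spaces; the index type `Empty` means none are imposed. -/
theorem cellIntegral_voronoiData_eq {w : EuclideanSpace ℝ (Fin d) → ℝ} {g : ℝ → ℝ}
    {x : Config n d} {i : Fin n} {δ : ℝ} (hδ : ∀ k, k ≠ i → 2 * δ ≤ ‖x k - x i‖)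
    (hg : ∀ r, δ ≤ r → g r = 0) :
    cellIntegral volume w g (voronoiData i x)
      = cellIntegral volume w g (x i, fun k : Empty => k.elim) := by
  unfold cellIntegral
  congr 1 with q
  by_cases hq : δ ≤ ‖q - x i‖
  · simp [radialField, voronoiData, hg _ hq]
  · rw [cellWeight_voronoiData_of_lt fun k hk => ?_]
    · simp [cellWeight, voronoiData]
    · have h1 := norm_sub_le (x k - q) (x i - q)
      rw [sub_sub_sub_cancel_right, norm_sub_rev (x k) q, norm_sub_rev (x i) q] at h1
      linarith [hδ k hk]

variable {Q : Set (EuclideanSpace ℝ (Fin d))} {φ : EuclideanSpace ℝ (Fin d) → ℝ} {g : ℝ → ℝ}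

theorem eventually_cellIntegral_voronoiData_eq {w : EuclideanSpace ℝ (Fin d) → ℝ} {R : ℝ}
    (hR : ∀ q, R < ‖q‖ → w q = 0) {g₁ g₂ : ℝ → ℝ} {x₀ : Config n d}
    (h : ∀ r, |r| ≤ R + ‖x₀‖ + 1 → g₁ r = g₂ r) (i : Fin n) :
    ∀ᶠ x in 𝓝 x₀, cellIntegral volume w g₁ (voronoiData i x)
      = cellIntegral volume w g₂ (voronoiData i x) := by
  filter_upwards [Metric.ball_mem_nhds x₀ one_pos] with x hx
  refine cellIntegral_congr fun q hq => h _ ?_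
  have h1 : ‖q‖ ≤ R := not_lt.1 fun hlt => hq (hR q hlt)
  have h2 := norm_le_norm_add_norm_sub' x x₀
  rw [mem_ball_iff_norm] at hx
  rw [abs_norm]
  have h3 : ‖x i‖ ≤ ‖x‖ := PiLp.norm_apply_le x i
  have h4 : ‖q - (voronoiData i x).1‖ ≤ ‖q‖ + ‖x i‖ := norm_sub_le q (x i)
  linarith

/-- The facts about the weight `Q.indicator φ` that the calculus of cell integrals needs. -/
theorem indicator_weight_spec (hQc : IsCompact Q) (hφ : ContinuousOn φ Q) :
    Measurable (Q.indicator φ) ∧ (∃ B, ∀ q, |Q.indicator φ q| ≤ B) ∧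
      ∃ R, ∀ q, R < ‖q‖ → Q.indicator φ q = 0 := by
  obtain ⟨R, hR⟩ := hQc.isBounded.exists_norm_le
  exact ⟨measurable_indicator_of_continuousOn hQc.measurableSet hφ, exists_abs_indicator_le hQc hφ,
    R, fun q hq => indicator_of_notMem (fun h => hq.not_ge (hR q h)) _⟩

theorem contDiffAt_cellIntegral_indicator [Nontrivial (EuclideanSpace ℝ (Fin d))]
    {ι : Type*} [Fintype ι] (hQ : Convex ℝ Q) (hQc : IsCompact Q) (hφ : ContinuousOn φ Q)
    (hg : ContDiff ℝ 1 g) {K : NNReal} (hgK : LipschitzWith K g) {G : ℝ} (hG : ∀ r, |g r| ≤ G)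
    (hd : 2 ≤ d ∨ g 0 = 0)
    {p : EuclideanSpace ℝ (Fin d) × (ι → EuclideanSpace ℝ (Fin d) × ℝ)}
    (hp : GeneralPosition Q p) :
    ContDiffAt ℝ 1 (cellIntegral volume (Q.indicator φ) g :
      EuclideanSpace ℝ (Fin d) × (ι → EuclideanSpace ℝ (Fin d) × ℝ) → _) p := by
  obtain ⟨hwm, ⟨B, hB⟩, -⟩ := indicator_weight_spec hQc hφ
  exact contDiffAt_cellIntegral volume hQ hQc hwm hB (fun q hq => indicator_of_notMem hq _)
    (fun q hq => continuousAt_indicator_of_notMem_frontier hφ hq) hg hgK hG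
    (by rwa [finrank_euclideanSpace_fin]) hp

theorem contDiffWithinAt_cellIntegral_voronoiData (hd : 1 ≤ d)
    (hQ : Convex ℝ Q) (hQc : IsCompact Q) (hQi : (interior Q).Nonempty) (hφ : ContinuousOn φ Q)
    (hg : ContDiff ℝ 1 g) {x₀ : Config n d} (hxQ : x₀ ∈ configsIn Q)
    (hx : ∀ i j, i ≠ j → x₀ i ≠ x₀ j) (i : Fin n) :
    ContDiffWithinAt ℝ 1 (fun x => cellIntegral volume (Q.indicator φ) g (voronoiData i x))
      (configsIn Q) x₀ := by
  have : Nontrivial (EuclideanSpace ℝ (Fin d)) :=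
    Module.nontrivial_of_finrank_pos (R := ℝ) (by rw [finrank_euclideanSpace_fin]; omega)
  obtain ⟨hwm, ⟨B, hB⟩, R, hR⟩ := indicator_weight_spec hQc hφ
  obtain ⟨h, hh, ⟨K, hK⟩, ⟨G, hG⟩, hgh⟩ := exists_lipschitz_bounded_eqOn hg (R + ‖x₀‖ + 1)
  have hev := eventually_cellIntegral_voronoiData_eq hR (fun r hr => (hgh r hr).symm) i
  have hgp := generalPosition_voronoiData hQ hQi hxQ hx i
  have hvd := (contDiff_voronoiData (d := d) i).contDiffAt (x := x₀)
  rcases Nat.lt_or_ge 1 d with hd2 | hd1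
  · refine ContDiffAt.contDiffWithinAt (ContDiffAt.congr_of_eventuallyEq ?_ hev)
    exact (contDiffAt_cellIntegral_indicator hQ hQc hφ hh hK hG (Or.inl hd2) hgp).comp x₀ hvd
  obtain rfl : d = 1 := le_antisymm hd1 hd
  obtain ⟨δ, hδ0, hδ⟩ : ∃ δ > 0, ∀ k, k ≠ i → 2 * δ < ‖x₀ k - x₀ i‖ := by
    have hev : ∀ᶠ δ : ℝ in 𝓝[>] 0, ∀ k, k ≠ i → 2 * δ < ‖x₀ k - x₀ i‖ := by
      rw [eventually_all]
      intro k
      by_cases hk : k = i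
      · simp [hk]
      · have h1 : Tendsto (fun δ : ℝ => 2 * δ) (𝓝[>] 0) (𝓝 0) := by
          have : Continuous fun δ : ℝ => 2 * δ := by fun_prop
          simpa using (this.tendsto 0).mono_left nhdsWithin_le_nhds
        filter_upwards [h1.eventually (gt_mem_nhds (norm_pos_iff.2 (sub_ne_zero.2 (hx k i hk))))]
          with δ hδ _ using hδ
    obtain ⟨δ, h1, h2⟩ := (hev.and self_mem_nhdsWithin).exists
    exact ⟨δ, h2, h1⟩
  have hδev : ∀ᶠ x in 𝓝 x₀, ∀ k, k ≠ i → 2 * δ ≤ ‖x k - x i‖ := by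
    rw [eventually_all]
    intro k
    by_cases hk : k = i
    · simp [hk]
    · have h1 : Continuous fun x : Config n 1 => ‖x k - x i‖ := by fun_prop
      filter_upwards [h1.continuousAt.eventually (lt_mem_nhds (hδ k hk))] with x hx _ using hx.le
  -- split off the part of the radial field that jumps at the centre
  let b : ContDiffBump (0 : ℝ) := ⟨δ / 2, δ, by positivity, by linarith⟩
  obtain ⟨Kb, hKb⟩ := b.contDiff (n := 1).lipschitzWith_of_hasCompactSupport b.hasCompactSupport
    one_ne_zero
  have hb1 : ∀ r, |b r| ≤ 1 := fun r => by rw [abs_of_nonneg b.nonneg]; exact b.le_one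
  have hb0 : b 0 = 1 := b.one_of_mem_closedBall (Metric.mem_closedBall_self (half_pos hδ0).le)
  have hbδ : ∀ r, δ ≤ r → b r = 0 := fun r hr => b.zero_of_le_dist (by
    rw [Real.dist_eq, sub_zero]
    exact hr.trans (le_abs_self r))
  have hbm : Measurable b := b.continuous.measurable
  have h1b : ∀ r, |(1 : ℝ) - 1 * b r| ≤ 1 := fun r => by
    rw [one_mul, abs_of_nonneg (sub_nonneg.2 b.le_one)]
    linarith [b.nonneg (x := r)]
  set w := Q.indicator φ with hw
  obtain ⟨Ψ, hΨ, hΨQ⟩ := exists_contDiff_integral_radialField_one hQ hQc hφ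
  -- Here `h = (h - h 0 * b) + h 0 * b` and `b = 1 - (1 - b)`. The profiles `h - h 0 * b` and `1 -
  -- b` vanish at `0`, so the general result applies to them; the bump `b` ignores the cell, and the
  -- constant profile over `Q` is the explicit `Ψ`.
  have hsplit : ∀ᶠ x in 𝓝[configsIn Q] x₀, cellIntegral volume w g (voronoiData i x)
      = cellIntegral volume w (fun r => h r - h 0 * b r) (voronoiData i x) + h 0 • (Ψ (x i)
        - cellIntegral volume w (fun r => 1 - 1 * b r) (x i, fun k : Empty => k.elim)) := by
    filter_upwards [nhdsWithin_le_nhds hev, nhdsWithin_le_nhds hδev, self_mem_nhdsWithin]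
      with x h1 h2 h3
    have h4 : Ψ (x i) = cellIntegral volume w (fun _ => 1) (x i, fun k : Empty => k.elim) := by
      rw [← hΨQ _ (h3 i)]
      simp [cellIntegral, cellWeight, hw]
    rw [h1, h4, cellIntegral_sub_smul hwm hB hR hh.continuous.measurable hG hbm hb1,
      cellIntegral_sub_smul hwm hB hR measurable_const (G₁ := 1) (fun _ => by simp) hbm hb1,
      cellIntegral_voronoiData_eq h2 hbδ]
    module
  have hx₀mem : x₀ ∈ configsIn Q := hxQ
  refine ContDiffWithinAt.congr_of_eventuallyEq_of_mem ?_ hsplit hx₀mem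
  refine ContDiffAt.contDiffWithinAt ?_
  have hxi : ContDiffAt ℝ 1 (fun x : Config n 1 => x i) x₀ := by fun_prop
  have hc1 : ContDiffAt ℝ 1 (fun x : Config n 1 =>
      cellIntegral volume w (fun r => h r - h 0 * b r) (voronoiData i x)) x₀ := by
    obtain ⟨K', hK'⟩ : ∃ K', LipschitzWith K' fun r => h r - h 0 * b r :=
      ⟨_, hK.sub ((lipschitzWith_smul (h 0)).comp hKb)⟩
    refine (contDiffAt_cellIntegral_indicator hQ hQc hφ (hh.sub (contDiff_const.mul b.contDiff))
      hK' (G := G + |h 0|) (fun r => ?_) (Or.inr ?_) hgp).comp x₀ hvd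
    · refine (abs_sub _ _).trans (add_le_add (hG r) ?_)
      rw [abs_mul]
      exact mul_le_of_le_one_right (abs_nonneg _) (hb1 r)
    · rw [hb0, mul_one, sub_self]
  have hc2 : ContDiffAt ℝ 1 (fun x : Config n 1 =>
      cellIntegral volume w (fun r => 1 - 1 * b r) (x i, fun k : Empty => k.elim)) x₀ := by
    obtain ⟨K', hK'⟩ : ∃ K', LipschitzWith K' fun r => 1 - 1 * b r :=
      ⟨_, (LipschitzWith.const (1 : ℝ)).sub ((lipschitzWith_smul (1 : ℝ)).comp hKb)⟩
    refine (contDiffAt_cellIntegral_indicator hQ hQc hφ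
      (contDiff_const.sub (contDiff_const.mul b.contDiff)) hK' h1b (Or.inr ?_) ?_).comp x₀
      (hxi.prodMk contDiffAt_const)
    · rw [hb0]; norm_num
    · exact ⟨fun k => k.elim, fun k => k.elim, fun k => k.elim⟩
  exact hc1.add ((((hΨ.contDiffAt).comp x₀ hxi).sub hc2).const_smul (h 0))

theorem hasGradientAt_multicenter (hn : 1 ≤ n) (hd : 1 ≤ d) (hQc : IsCompact Q)
    (hφ : ContinuousOn φ Q) {f : ℝ → ℝ} (hf : ContDiff ℝ 1 f) (hmono : StrictMonoOn f (Ici 0))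
    {x : Config n d} (hx : ∀ i j, i ≠ j → x i ≠ x j) :
    HasGradientAt (multicenter Q f φ) (WithLp.toLp 2 fun i =>
      -cellIntegral volume (Q.indicator φ) (deriv f) (voronoiData i x)) x := by
  have : Nontrivial (EuclideanSpace ℝ (Fin d)) :=
    Module.nontrivial_of_finrank_pos (R := ℝ) (by rw [finrank_euclideanSpace_fin]; omega)
  have : Nonempty (Fin n) := ⟨⟨0, hn⟩⟩
  obtain ⟨hwm, ⟨B, hB⟩, R, hR⟩ := indicator_weight_spec hQc hφ
  convert hasGradientAt_integral_iInf hwm hB hR hf hmono hx using 1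
  ext y
  rw [multicenter, ← integral_indicator hQc.measurableSet]
  congr 1 with q
  by_cases hq : q ∈ Q <;> simp [hq]

theorem multicenter_congr {f F : ℝ → ℝ} (h : EqOn F f (Ici 0)) :
    (multicenter Q f φ : Config n d → ℝ) = multicenter Q F φ := by
  ext x
  unfold multicenter
  congr 1 with q
  simp only [h (norm_nonneg _ : (0 : ℝ) ≤ ‖q - x _‖)]

end Voronoi

theorem mainTheorem4 (n d : ℕ) (hn : 1 ≤ n)
    (Q : Set (EuclideanSpace ℝ (Fin d))) (hQconv : Convex ℝ Q) (hQcomp : IsCompact Q)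
    (φ : EuclideanSpace ℝ (Fin d) → ℝ) (hφcont : ContinuousOn φ Q)
    (hφpos : ∀ q ∈ Q, 0 < φ q) (hφone : ∫ q in Q, φ q = 1)
    (f : ℝ → ℝ) (hfmono : StrictMonoOn f (Set.Ici 0))
    (hfsmooth : ContDiffOn ℝ 3 f (Set.Ici 0)) (hf0 : f 0 = 0) :
    (∀ x ∈ (configsIn Q \ coincident Q : Set (Config n d)),
      DifferentiableAt ℝ (multicenter Q f φ) x) ∧
    ContDiffOn ℝ 1 (∇ (multicenter Q f φ))
      (configsIn Q \ coincident Q : Set (Config n d)) := by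
  rcases Nat.eq_zero_or_pos d with rfl | hd
  -- For `d = 0` the configuration space is a single point.
  · exact ⟨fun x _ => differentiable_of_subsingleton x, contDiff_of_subsingleton.contDiffOn⟩
  -- A convex set with empty interior is null and could not carry total mass one.
  have hQi : (interior Q).Nonempty :=
    nonempty_interior_of_setIntegral_ne_zero volume hQconv (by rw [hφone]; exact one_ne_zero)
  obtain ⟨F, hF, hFf⟩ := exists_contDiff_eqOn_Ici (hfsmooth.of_le (by norm_num))
  have hF1 : ContDiff ℝ 1 F := hF.of_le (by norm_num)
  have hFd : ContDiff ℝ 1 (deriv F) :=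
    (contDiff_succ_iff_deriv.1 (by simpa [one_add_one_eq_two] using hF)).2.2
  have hFmono : StrictMonoOn F (Set.Ici 0) := hfmono.congr hFf.symm
  have hne : ∀ x ∈ (configsIn Q \ coincident Q : Set (Config n d)), ∀ i j, i ≠ j → x i ≠ x j :=
    fun x hx i j hij h => hx.2 ⟨hx.1, i, j, hij, h⟩
  rw [multicenter_congr hFf]
  have hgrad := fun x hx =>
    hasGradientAt_multicenter hn hd hQcomp hφcont hF1 hFmono (hne x hx)
  refine ⟨fun x hx => (hgrad x hx).differentiableAt, fun x hx => ?_⟩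
  have hc : ContDiffWithinAt ℝ 1 (fun y : Config n d => (WithLp.toLp 2 fun i =>
      -cellIntegral volume (Q.indicator φ) (deriv F) (voronoiData i y) : Config n d))
      (configsIn Q) x :=
    (contDiffWithinAt_piLp 2).2 fun i => (contDiffWithinAt_cellIntegral_voronoiData hd hQconv
      hQcomp hQi hφcont hFd hx.1 (hne x hx) i).neg
  exact (hc.mono Set.sdiff_subset).congr_of_mem (fun y hy => (hgrad y hy).gradient) hx
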